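/- **Setting.** Let $\Omega\subset\mathbb R^2$ be a bounded domain with Lipschitz boundary. For $m=(m',m_3)\colon\Omega\to\mathbb R^3$ with $m'$ taking values in $\mathbb R^2$, let $\mathcal A$ be the set of all $m\in H^1(\Omega;\mathbb R^3)$ with $|m|=1$ a.e. in $\Omega$, $m=-e_3$ on $\partial\Omega$ (that is, $m+e_3\in H^1_0(\Omega;\mathbb R^3)$) and $\frac1{4\pi}\int_\Omega m\cdot(\partial_1m\times\partial_2m)\,dx=1$; each $m\in\mathcal A$ is extended to $\mathbb R^2$ by $-e_3$. Let $$\Phi(x)=\Big(-\frac{2x}{1+|x|^2},\ \frac{1-|x|^2}{1+|x|^2}\Big),\qquad x\in\mathbb R^2 .$$ Let $\kappa_n>0$ with $\kappa_n\to0$, and let $R_0\in SO(3)$ with $R_0e_3=e_3$, $r_0>0$ and $a_0\in\Omega$. A sequence $m_{\kappa_n}\in\mathcal A$ is said to BP-converge to $(R_0,r_0,a_0)$ if there are $R_n\in SO(3)$, $\rho_n>0$ and $a_n\in\Omega$ such that, with $\phi_n(x)=R_n\Phi(\rho_n^{-1}(x-a_n))$, $$\limsup_{n\to\infty}\kappa_n^{-2}\int_{\mathbb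 R^2}|\nabla(m_{\kappa_n}-\phi_n)|^2\,dx<\infty,\qquad R_n\to R_0,\qquad \frac{\rho_n}{\kappa_n}\to r_0,\qquad a_n\to a_0 .$$ For $\lambda\in\mathbb R$ define $$\mathcal E_\kappa(m)=\int_\Omega\big(|\nabla m|^2-2\kappa\,m'\cdot\nabla m_3\big)\,dx,\qquad \mathcal E_{\kappa,\lambda}(m)=\int_\Omega\Big(|\nabla m|^2-2\kappa\,m'\cdot\nabla m_3+\frac{\lambda}{|\log\kappa|}|m'|^2\Big)\,dx .$$ **Proposition.** If $m_{\kappa_n}\in\mathcal A$ BP-converges to $(R_0,r_0,a_0)$, then $$\lim_{n\to\infty}\frac1{\kappa_n^2|\log\kappa_n|}\int_\Omega|m_{\kappa_n}'|^2\,dx=8\pi r_0^2 .$$ Hence, for every $\lambda\in\mathbb R$, also $$\lim_{n\to\infty}\frac{\mathcal E_{\kappa_n,\lambda}(m_{\kappa_n})-\mathcal E_{\kappa_n}(m_{\kappa_n})}{\kappa_n^2}=8\pi\lambda r_0^2,$$ and the anisotropy adds $8\pi\lambda r_0^2$ to the $\Gamma$-limit, whatever the shape of $\Omega$: the lower and the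 upper $\Gamma$-limit satisfy $$\inf\ \liminf_{n\to\infty}\frac{\mathcal E_{\kappa_n,\lambda}(m_{\kappa_n})-8\pi}{\kappa_n^2}=\inf\ \liminf_{n\to\infty}\frac{\mathcal E_{\kappa_n}(m_{\kappa_n})-8\pi}{\kappa_n^2}+8\pi\lambda r_0^2,$$ and the same with $\limsup$ in place of $\liminf$ on both sides, where each infimum (in $[-\infty,\infty]$) is over all sequences $m_{\kappa_n}\in\mathcal A$ that BP-converge to $(R_0,r_0,a_0)$. -/

import Mathlib

open MeasureTheory Filter Topology
open scoped ENNReal NNReal Matrix ContDiff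

noncomputable section

namespace Skyrmion

/-- The Euclidean plane. -/
abbrev E2 : Type := EuclideanSpace ℝ (Fin 2)

/-- Euclidean three-space; the coordinates `0, 1` are the in-plane ones, `2` is the vertical one. -/
abbrev E3 : Type := EuclideanSpace ℝ (Fin 3)

/-- The vertical unit vector. -/
def e3 : E3 := EuclideanSpace.single 2 1

/-- Classical partial derivative with respect to the `i`-th coordinate of the plane. -/
def partialDeriv {F : Type*} [NormedAddCommGroup F] [NormedSpace ℝ F]
    (i : Fin 2) (f : E2 → F) (x : E2) : F :=
  fderiv ℝ f x (EuclideanSpace.single i 1)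

/-! ### Bounded Lipschitz domains -/

/-- The boundary of `Ω` is Lipschitz: near each boundary point, and in suitable orthonormal
coordinates, `Ω` is the set of points above the graph of a Lipschitz function. -/
def HasLipschitzBoundary (Ω : Set E2) : Prop :=
  ∀ p ∈ frontier Ω, ∃ (e : E2 ≃ₗᵢ[ℝ] E2) (γ : ℝ → ℝ) (K : ℝ≥0), LipschitzWith K γ ∧
    ∃ U ∈ 𝓝 p, ∀ x ∈ U, (x ∈ Ω ↔ γ (e x 0) < e x 1)

/-- Bounded domains (nonempty, open, connected sets) with Lipschitz boundary. -/
structure IsBoundedLipschitzDomain (Ω : Set E2) : Prop where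
  isOpen : IsOpen Ω
  isConnected : IsConnected Ω
  isBounded : Bornology.IsBounded Ω
  lipschitz : HasLipschitzBoundary Ω

/-! ### Weak derivatives and Sobolev spaces of maps with values in three-space -/

/-- `g` is a weak `i`-th partial derivative of `f` in the open set `U`. -/
structure HasWeakPartial (U : Set E2) (i : Fin 2) (f g : E2 → E3) : Prop where
  locallyIntegrableOn : LocallyIntegrableOn f U
  locallyIntegrableOn_deriv : LocallyIntegrableOn g U
  integral_eq : ∀ η : E2 → ℝ, ContDiff ℝ ∞ η → HasCompactSupport η → tsupport η ⊆ U →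
    ∫ x in U, partialDeriv i η x • f x = - ∫ x in U, η x • g x

open Classical in
/-- The weak `i`-th partial derivative of `f` in `U` (unique up to null sets in `U`; set to `0` if
there is none). -/
def weakPartial (U : Set E2) (i : Fin 2) (f : E2 → E3) : E2 → E3 :=
  if h : ∃ g, HasWeakPartial U i f g then h.choose else 0

/-- `f ∈ H¹(U; ℝ³)`. -/
structure MemH1 (U : Set E2) (f : E2 → E3) : Prop where
  memLp : MemLp f 2 (volume.restrict U)
  exists_deriv : ∀ i, ∃ g, HasWeakPartial U i f g ∧ MemLp g 2 (volume.restrict U)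

/-- `f ∈ H¹₀(U; ℝ³)`, the closure in `H¹(U; ℝ³)` of the smooth maps with compact support
in `U`. -/
structure MemH10 (U : Set E2) (f : E2 → E3) : Prop where
  memH1 : MemH1 U f
  exists_approx : ∃ v : ℕ → E2 → E3,
    (∀ k, ContDiff ℝ ∞ (v k) ∧ HasCompactSupport (v k) ∧ tsupport (v k) ⊆ U) ∧
    Tendsto (fun k => eLpNorm (fun x => v k x - f x) 2 (volume.restrict U)) atTop (𝓝 0) ∧
    ∀ i, Tendsto (fun k => eLpNorm (fun x => partialDeriv i (v k) x - weakPartial U i f x) 2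
      (volume.restrict U)) atTop (𝓝 0)

/-! ### Admissible magnetizations and energies -/

/-- The degree `(4π)⁻¹ ∫_Ω m · (∂₁m × ∂₂m)`. -/
def degree (Ω : Set E2) (m : E2 → E3) : ℝ :=
  (1 / (4 * Real.pi)) * ∫ x in Ω,
    (m x).ofLp ⬝ᵥ ((weakPartial Ω 0 m x).ofLp ⨯₃ (weakPartial Ω 1 m x).ofLp)

/-- The admissible class `{m ∈ H¹(Ω; 𝕊²) : m = -e₃ on ∂Ω, 𝒩(m) = 1}`. The boundary condition is in
the sense of `m + e₃ ∈ H¹₀(Ω; ℝ³)`. Every admissible map is extended to the plane by `-e₃`, so it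
is represented here by that extension. -/
structure Admissible (Ω : Set E2) (m : E2 → E3) : Prop where
  memH1 : MemH1 Ω m
  norm_eq_one : ∀ᵐ x ∂(volume.restrict Ω), ‖m x‖ = 1
  boundary : MemH10 Ω (fun x => m x + e3)
  eq_outside : ∀ x, x ∉ Ω → m x = -e3
  degree_eq_one : degree Ω m = 1

/-- `|∇m|²` in `Ω`. -/
def gradSq (Ω : Set E2) (m : E2 → E3) (x : E2) : ℝ :=
  ∑ i, ‖weakPartial Ω i m x‖ ^ 2

/-- `m' · ∇m₃` in `Ω`, where `m = (m', m₃)`. -/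
def dmiDensity (Ω : Set E2) (m : E2 → E3) (x : E2) : ℝ :=
  m x 0 * weakPartial Ω 0 m x 2 + m x 1 * weakPartial Ω 1 m x 2

/-- `|m'|²`, where `m = (m', m₃)`. -/
def inPlaneSq (m : E2 → E3) (x : E2) : ℝ := m x 0 ^ 2 + m x 1 ^ 2

/-- The energy `∫_Ω (|∇m|² - 2κ m' · ∇m₃)`. -/
def energy (Ω : Set E2) (κ : ℝ) (m : E2 → E3) : ℝ :=
  ∫ x in Ω, (gradSq Ω m x - 2 * κ * dmiDensity Ω m x)

/-- The energy with anisotropy, `∫_Ω (|∇m|² - 2κ m' · ∇m₃ + (λ / |log κ|) |m'|²)`. -/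
def anisotropicEnergy (Ω : Set E2) (lam κ : ℝ) (m : E2 → E3) : ℝ :=
  ∫ x in Ω, (gradSq Ω m x - 2 * κ * dmiDensity Ω m x + lam / |Real.log κ| * inPlaneSq m x)

/-! ### Belavin-Polyakov profiles and convergence -/

/-- The standard Belavin-Polyakov profile
`Φ(x) = (-2x / (1 + |x|²), (1 - |x|²) / (1 + |x|²))`. -/
def bpProfile (x : E2) : E3 :=
  !₂[-(2 * x 0) / (1 + ‖x‖ ^ 2), -(2 * x 1) / (1 + ‖x‖ ^ 2), (1 - ‖x‖ ^ 2) / (1 + ‖x‖ ^ 2)]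

/-- The rotation group `SO(3)`. -/
abbrev SO3 : Type := Matrix.specialOrthogonalGroup (Fin 3) ℝ

/-- The action of a rotation on a vector. -/
def rotate (R : SO3) (v : E3) : E3 := WithLp.toLp 2 ((R : Matrix (Fin 3) (Fin 3) ℝ) *ᵥ v.ofLp)

/-- The profile `x ↦ R Φ(ρ⁻¹ (x - a))`. -/
def bpMap (R : SO3) (ρ : ℝ) (a : E2) (x : E2) : E3 := rotate R (bpProfile (ρ⁻¹ • (x - a)))

/-- The squared Dirichlet distance `∫_{ℝ²} |∇(m - φ)|²`, with values in `[0, ∞]`. -/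
def dirichletDistSq (m φ : E2 → E3) : ℝ≥0∞ :=
  ∫⁻ x, ∑ i, ‖weakPartial Set.univ i (fun y => m y - φ y) x‖ₑ ^ 2

/-- The set `{R₀ ∈ SO(3) : R₀ e₃ = e₃} × (0, ∞) × Ω` of possible limits. -/
structure LimitAdmissible (Ω : Set E2) (R₀ : SO3) (r₀ : ℝ) (a₀ : E2) : Prop where
  rotate_e3 : rotate R₀ e3 = e3
  pos : 0 < r₀
  mem : a₀ ∈ Ω

/-- BP-convergence of the admissible maps `m n`, at the scales `κ n`, to `(R₀, r₀, a₀)`. -/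
def BPConverges (Ω : Set E2) (κ : ℕ → ℝ) (m : ℕ → E2 → E3)
    (R₀ : SO3) (r₀ : ℝ) (a₀ : E2) : Prop :=
  (∀ n, Admissible Ω (m n)) ∧
  ∃ (R : ℕ → SO3) (ρ : ℕ → ℝ) (a : ℕ → E2), (∀ n, 0 < ρ n) ∧ (∀ n, a n ∈ Ω) ∧
    limsup (fun n => ENNReal.ofReal ((κ n ^ 2)⁻¹) * dirichletDistSq (m n) (bpMap (R n) (ρ n) (a n)))
      atTop < ⊤ ∧
    Tendsto R atTop (𝓝 R₀) ∧
    Tendsto (fun n => ρ n / κ n) atTop (𝓝 r₀) ∧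
    Tendsto a atTop (𝓝 a₀)

/-! ### Lower and upper Gamma-limits -/

/-- The lower Gamma-limit of `(F_κ - 8π) / κ²` along `κ n` with respect to BP-convergence: the
infimum of the inferior limits over all sequences that BP-converge to `(R₀, r₀, a₀)`. -/
def gammaLiminf (Ω : Set E2) (F : ℝ → (E2 → E3) → ℝ) (κ : ℕ → ℝ)
    (R₀ : SO3) (r₀ : ℝ) (a₀ : E2) : EReal :=
  ⨅ (m : ℕ → E2 → E3) (_ : BPConverges Ω κ m R₀ r₀ a₀),
    liminf (fun n => (((F (κ n) (m n) - 8 * Real.pi) / κ n ^ 2 : ℝ) : EReal)) atTop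

/-- The upper Gamma-limit of `(F_κ - 8π) / κ²` along `κ n` with respect to BP-convergence: the
infimum of the superior limits over all sequences that BP-converge to `(R₀, r₀, a₀)`. -/
def gammaLimsup (Ω : Set E2) (F : ℝ → (E2 → E3) → ℝ) (κ : ℕ → ℝ)
    (R₀ : SO3) (r₀ : ℝ) (a₀ : E2) : EReal :=
  ⨅ (m : ℕ → E2 → E3) (_ : BPConverges Ω κ m R₀ r₀ a₀),
    limsup (fun n => (((F (κ n) (m n) - 8 * Real.pi) / κ n ^ 2 : ℝ) : EReal)) atTop

end Skyrmion

end

open Skyrmion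

/-!
Write `φ = R Φ(ρ⁻¹ (· - a))` for the profile attached to `m = m_{κ_n}` and `ψ = φ + R e₃` for its
tail, which decays like `ρ / |x - a|`; explicitly `|ψ|² = 4 ρ² / (ρ² + |x - a|²)`.

**The error is of order `κ`.** The map `m + e₃` is an `H¹` limit of test functions in `Ω`, so its
extension by zero has a weak gradient on the plane, and `m + e₃ - ψ` has the same gradient as
`m - φ`, of `L²` norm `O(κ)`. A Poincaré inequality cannot be applied to `m + e₃ - ψ`, which does
not vanish on `∂Ω`, but it can be applied to `m + e₃ - χ ψ` with a fixed cutoff `χ` equal to `1` on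
`Ω`: the gradient of `(1 - χ) ψ` is `O(ρ) = O(κ)` because it only sees points away from `a`. Hence
`‖m + e₃ - ψ‖_{L²(Ω)} = O(κ)` (`exists_eLpNorm_sub_bpTail_le`).

**The tail carries the logarithm.** On a disc of radius `d` about `a` the integral of `|ψ|²` is
`4 π ρ² log (1 + d² / ρ²)`, which is asymptotic to `8 π r₀² κ² |log κ|` for every `d`; as `Ω` lies
between two such discs, the integral over `Ω` has the same asymptotics
(`tendsto_integral_norm_sq_bpTail`). Since `R → R₀` and `R₀` fixes `e₃`, the vertical component of
`ψ` is a vanishing fraction of `ψ` plus a term of order `ρ² / (ρ² + |x - a|²)`, whose `L²` norm is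
`O(ρ)` without a logarithm. So the in-plane part of `ψ` has the asymptotics of `ψ`, and it differs
from `m'` by `O(κ) = o(κ |log κ|^{1/2})` in `L²(Ω)` (`tendsto_integral_inPlaneSq`).

The statements on the energies follow: the two rescaled energies differ by a sequence converging to
the same constant along every BP-converging sequence, which shifts each inferior and superior limit,
and then the infima, by that constant.
-/

namespace Skyrmion

/-! ### Weak derivatives -/

theorem integrable_smul_of_tsupport_subset {U : Set E2} {η : E2 → ℝ} {g : E2 → E3}
    (hη : Continuous η) (hc : HasCompactSupport η) (hU : tsupport η ⊆ U)
    (hg : LocallyIntegrableOn g U) : Integrable (fun x => η x • g x) := by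
  have h : IntegrableOn g (tsupport η) := hg.integrableOn_compact_subset hU hc
  have h2 : IntegrableOn (fun x => η x • g x) (tsupport η) :=
    h.continuousOn_smul hη.continuousOn hc
  refine (integrableOn_iff_integrable_of_support_subset ?_).1 h2
  exact (Function.support_smul_subset_left η g).trans (subset_tsupport η)

theorem HasWeakPartial.ae_eq {U : Set E2} (hU : IsOpen U) {i : Fin 2} {f g g' : E2 → E3}
    (h : HasWeakPartial U i f g) (h' : HasWeakPartial U i f g') :
    g =ᵐ[volume.restrict U] g' := by
  have key := hU.ae_eq_zero_of_integral_contDiff_smul_eq_zero (μ := volume)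
    (f := fun x => g x - g' x) (h.locallyIntegrableOn_deriv.sub h'.locallyIntegrableOn_deriv) ?_
  · filter_upwards [(ae_restrict_iff' hU.measurableSet).2 key] with x hx
    exact sub_eq_zero.1 hx
  · intro η hη hc hs
    have e1 := h.integral_eq η hη hc hs
    have e2 := h'.integral_eq η hη hc hs
    have hz : ∀ k : E2 → E3, ∀ x, x ∉ U → η x • k x = 0 := fun k x hx => by
      rw [image_eq_zero_of_notMem_tsupport (fun h => hx (hs h)), zero_smul]
    rw [setIntegral_eq_integral_of_forall_compl_eq_zero (f := fun x => η x • g x) (hz g)] at e1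
    rw [setIntegral_eq_integral_of_forall_compl_eq_zero (f := fun x => η x • g' x) (hz g')] at e2
    simp only [smul_sub]
    rw [integral_sub (integrable_smul_of_tsupport_subset hη.continuous hc hs
      h.locallyIntegrableOn_deriv) (integrable_smul_of_tsupport_subset hη.continuous hc hs
      h'.locallyIntegrableOn_deriv), sub_eq_zero]
    exact neg_injective (e1.symm.trans e2)

theorem HasWeakPartial.weakPartial_ae_eq {U : Set E2} (hU : IsOpen U) {i : Fin 2} {f g : E2 → E3}
    (h : HasWeakPartial U i f g) : weakPartial U i f =ᵐ[volume.restrict U] g := by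
  have hex : ∃ g, HasWeakPartial U i f g := ⟨g, h⟩
  have : weakPartial U i f = hex.choose := by simp only [weakPartial, dif_pos hex]
  rw [this]
  exact hex.choose_spec.ae_eq hU h

theorem MemH1.memLp_weakPartial {U : Set E2} (hU : IsOpen U) {f : E2 → E3} (h : MemH1 U f)
    (i : Fin 2) : MemLp (weakPartial U i f) 2 (volume.restrict U) := by
  obtain ⟨g, hg, hL⟩ := h.exists_deriv i
  exact hL.ae_eq (hg.weakPartial_ae_eq hU).symm

/-- The pairing with a fixed `L²` function is continuous for `L²` convergence. -/
theorem tendsto_integral_smul_of_tendsto_eLpNorm {μ : Measure E2} {ζ : E2 → ℝ}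
    (hζ : MemLp ζ 2 μ) {W : ℕ → E2 → E3} {w : E2 → E3} (hw : Integrable (fun x => ζ x • w x) μ)
    (hW : ∀ k, Integrable (fun x => ζ x • W k x) μ)
    (hm : ∀ k, AEStronglyMeasurable (fun x => W k x - w x) μ)
    (hlim : Tendsto (fun k => eLpNorm (fun x => W k x - w x) 2 μ) atTop (𝓝 0)) :
    Tendsto (fun k => ∫ x, ζ x • W k x ∂μ) atTop (𝓝 (∫ x, ζ x • w x ∂μ)) := by
  refine tendsto_integral_of_L1' _ hw.1 (Eventually.of_forall hW) ?_
  have hb : ∀ k, eLpNorm ((fun x => ζ x • W k x) - fun x => ζ x • w x) 1 μ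
      ≤ eLpNorm ζ 2 μ * eLpNorm (fun x => W k x - w x) 2 μ := by
    intro k
    have : ((fun x => ζ x • W k x) - fun x => ζ x • w x) = ζ • (fun x => W k x - w x) := by
      ext1 x; simp [smul_sub]
    rw [this]
    exact eLpNorm_smul_le_mul_eLpNorm (hm k) hζ.1
  refine tendsto_of_tendsto_of_tendsto_of_le_of_le tendsto_const_nhds ?_ (fun _ => zero_le) hb
  have := ENNReal.Tendsto.const_mul (a := eLpNorm ζ 2 μ) hlim (Or.inr hζ.2.ne)
  simpa using this

/-- Weak derivatives are stable under `L²` convergence of continuously differentiable functions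
and of their derivatives. -/
theorem hasWeakPartial_univ_of_tendsto {i : Fin 2} {W : ℕ → E2 → E3} {w g : E2 → E3}
    (hW : ∀ k, ContDiff ℝ 1 (W k)) (hw : LocallyIntegrable w) (hg : LocallyIntegrable g)
    (h1 : Tendsto (fun k => eLpNorm (fun x => W k x - w x) 2 volume) atTop (𝓝 0))
    (h2 : Tendsto (fun k => eLpNorm (fun x => partialDeriv i (W k) x - g x) 2 volume)
      atTop (𝓝 0)) :
    HasWeakPartial Set.univ i w g := by
  refine ⟨hw.locallyIntegrableOn _, hg.locallyIntegrableOn _, ?_⟩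
  intro η hη hc _
  rw [Measure.restrict_univ]
  have hd : ∀ k, Continuous (partialDeriv i (W k)) := fun k =>
    ((hW k).continuous_fderiv one_ne_zero).clm_apply continuous_const
  have hdη : Continuous (partialDeriv i η) :=
    (hη.continuous_fderiv (by simp)).clm_apply continuous_const
  have hcη : HasCompactSupport (partialDeriv i η) := hc.fderiv_apply ℝ _
  have int : ∀ (ζ : E2 → ℝ), Continuous ζ → HasCompactSupport ζ → ∀ f : E2 → E3,
      LocallyIntegrable f → Integrable (fun x => ζ x • f x) := fun ζ a b f c =>
    integrable_smul_of_tsupport_subset a b (Set.subset_univ _) (c.locallyIntegrableOn _)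
  have t1 := tendsto_integral_smul_of_tendsto_eLpNorm (μ := volume)
    (hdη.memLp_of_hasCompactSupport hcη) (int _ hdη hcη _ hw)
    (fun k => int _ hdη hcη _ (hW k).continuous.locallyIntegrable)
    (fun k => (hW k).continuous.aestronglyMeasurable.sub hw.aestronglyMeasurable) h1
  have t2 := tendsto_integral_smul_of_tendsto_eLpNorm (μ := volume)
    (hη.continuous.memLp_of_hasCompactSupport hc) (int _ hη.continuous hc _ hg)
    (fun k => int _ hη.continuous hc _ (hd k).locallyIntegrable)
    (fun k => (hd k).aestronglyMeasurable.sub hg.aestronglyMeasurable) h2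
  have heq : ∀ k, ∫ x, η x • partialDeriv i (W k) x = - ∫ x, partialDeriv i η x • W k x :=
    fun k => integral_smul_fderiv_eq_neg_fderiv_smul_of_integrable
      (int _ hdη hcη _ (hW k).continuous.locallyIntegrable)
      (int _ hη.continuous hc _ (hd k).locallyIntegrable)
      (int _ hη.continuous hc _ (hW k).continuous.locallyIntegrable)
      (fun x _ => (hη.differentiable (by simp)).differentiableAt)
      (fun x _ => ((hW k).differentiable one_ne_zero).differentiableAt)
  simp only [heq] at t2
  rw [← tendsto_nhds_unique t1.neg t2, neg_neg]

/-! ### Rotations and the tail of a Belavin-Polyakov profile -/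

theorem dotProduct_mulVec_self (R : SO3) (u : Fin 3 → ℝ) :
    ((R : Matrix (Fin 3) (Fin 3) ℝ) *ᵥ u) ⬝ᵥ ((R : Matrix (Fin 3) (Fin 3) ℝ) *ᵥ u) = u ⬝ᵥ u := by
  have h : (R : Matrix (Fin 3) (Fin 3) ℝ)ᵀ * (R : Matrix (Fin 3) (Fin 3) ℝ) = 1 :=
    (Matrix.mem_orthogonalGroup_iff' _ _).1 (Matrix.mem_specialOrthogonalGroup_iff.1 R.2).1
  rw [Matrix.dotProduct_mulVec, Matrix.vecMul_mulVec, h, Matrix.vecMul_one]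

theorem norm_rotate (R : SO3) (v : E3) : ‖rotate R v‖ = ‖v‖ := by
  have h := dotProduct_mulVec_self R v.ofLp
  rw [← sq_eq_sq₀ (norm_nonneg _) (norm_nonneg _), EuclideanSpace.real_norm_sq_eq,
    EuclideanSpace.real_norm_sq_eq]
  simpa [rotate, dotProduct, pow_two] using h

/-- The action of a rotation, as a continuous linear map. -/
noncomputable def rotateL (R : SO3) : E3 →L[ℝ] E3 :=
  LinearMap.toContinuousLinearMap
    { toFun := rotate R
      map_add' := fun u v => by simp [rotate, Matrix.mulVec_add]
      map_smul' := fun c v => by simp [rotate, Matrix.mulVec_smul] }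

theorem rotateL_apply (R : SO3) (v : E3) : rotateL R v = rotate R v := rfl

/-- The inclusion `z ↦ (-z, 0)` of the plane. -/
noncomputable def negPlane : E2 →L[ℝ] E3 :=
  LinearMap.toContinuousLinearMap
    { toFun := fun z => !₂[-z 0, -z 1, 0]
      map_add' := fun u v => by ext i; fin_cases i <;> simp <;> ring
      map_smul' := fun c v => by ext i; fin_cases i <;> simp }

theorem negPlane_apply (z : E2) : negPlane z = !₂[-z 0, -z 1, 0] := rfl

theorem norm_sq_negPlane_add (z : E2) (t : ℝ) : ‖negPlane z + t • e3‖ ^ 2 = t ^ 2 + ‖z‖ ^ 2 := by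
  rw [EuclideanSpace.real_norm_sq_eq, EuclideanSpace.real_norm_sq_eq]
  simp [Fin.sum_univ_three, Fin.sum_univ_two, negPlane_apply, e3]
  ring

theorem norm_negPlane (z : E2) : ‖negPlane z‖ = ‖z‖ := by
  have := norm_sq_negPlane_add z 0
  simpa using this

/-- The profile `R Φ(ρ⁻¹ (x - a))` minus its limit `-R e₃` at infinity. -/
noncomputable def bpTail (R : SO3) (ρ : ℝ) (a x : E2) : E3 := bpMap R ρ a x + rotate R e3

theorem bpProfile_smul_add_e3 {ρ : ℝ} (hρ : 0 < ρ) (z : E2) :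
    bpProfile (ρ⁻¹ • z) + e3 = (2 * ρ * (ρ ^ 2 + ‖z‖ ^ 2)⁻¹) • (negPlane z + ρ • e3) := by
  have h1 : ρ ^ 2 + ‖z‖ ^ 2 ≠ 0 := by positivity
  have h2 : (1 : ℝ) + ‖ρ⁻¹ • z‖ ^ 2 = (ρ ^ 2 + ‖z‖ ^ 2) / ρ ^ 2 := by
    rw [norm_smul, mul_pow, Real.norm_eq_abs, sq_abs]; field_simp
  have h3 : (1 : ℝ) - ‖ρ⁻¹ • z‖ ^ 2 = (ρ ^ 2 - ‖z‖ ^ 2) / ρ ^ 2 := by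
    rw [norm_smul, mul_pow, Real.norm_eq_abs, sq_abs]; field_simp
  ext i
  fin_cases i
  all_goals
    simp only [bpProfile, h2, h3, negPlane_apply, e3]
    simp
    field_simp
  ring

theorem bpTail_eq (R : SO3) {ρ : ℝ} (hρ : 0 < ρ) (a x : E2) :
    bpTail R ρ a x =
      (2 * ρ * (ρ ^ 2 + ‖x - a‖ ^ 2)⁻¹) • rotateL R (negPlane (x - a) + ρ • e3) := by
  rw [← map_smul, ← bpProfile_smul_add_e3 hρ, map_add]
  rfl

theorem norm_sq_bpTail (R : SO3) {ρ : ℝ} (hρ : 0 < ρ) (a x : E2) :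
    ‖bpTail R ρ a x‖ ^ 2 = 4 * ρ ^ 2 / (ρ ^ 2 + ‖x - a‖ ^ 2) := by
  have h1 : ρ ^ 2 + ‖x - a‖ ^ 2 ≠ 0 := by positivity
  rw [bpTail_eq R hρ, norm_smul, rotateL_apply, norm_rotate, mul_pow, norm_sq_negPlane_add,
    Real.norm_eq_abs, sq_abs]
  field_simp
  ring

theorem contDiff_bpTail (R : SO3) {ρ : ℝ} (hρ : 0 < ρ) (a : E2) {n : WithTop ℕ∞} :
    ContDiff ℝ n (bpTail R ρ a) := by
  have : bpTail R ρ a = fun x =>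
      (2 * ρ * (ρ ^ 2 + ‖x - a‖ ^ 2)⁻¹) • rotateL R (negPlane (x - a) + ρ • e3) :=
    funext fun x => bpTail_eq R hρ a x
  rw [this]
  have h : ContDiff ℝ n fun x : E2 => ρ ^ 2 + ‖x - a‖ ^ 2 :=
    contDiff_const.add ((contDiff_id.sub contDiff_const).norm_sq ℝ)
  refine (contDiff_const.mul (h.inv fun x => by positivity)).smul ?_
  exact (rotateL R).contDiff.comp
    ((negPlane.contDiff.comp (contDiff_id.sub contDiff_const)).add contDiff_const)

theorem norm_partialDeriv_bpTail_le (R : SO3) {ρ : ℝ} (hρ : 0 < ρ) (a x : E2) (i : Fin 2) :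
    ‖partialDeriv i (bpTail R ρ a) x‖ ≤ 6 * ρ / (ρ ^ 2 + ‖x - a‖ ^ 2) := by
  set e : E2 := EuclideanSpace.single i 1 with he
  have hen : ‖e‖ = 1 := by simp [he]
  set q : ℝ := ρ ^ 2 + ‖x - a‖ ^ 2 with hq
  have hq0 : 0 < q := by positivity
  set A : E3 := rotateL R (negPlane (x - a) + ρ • e3) with hA
  have hAn : ‖A‖ ^ 2 = q := by
    rw [hA, rotateL_apply, norm_rotate, norm_sq_negPlane_add]
  have hfun : bpTail R ρ a = fun x =>
      (2 * ρ * (ρ ^ 2 + ‖x - a‖ ^ 2)⁻¹) • rotateL R (negPlane (x - a) + ρ • e3) :=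
    funext fun x => bpTail_eq R hρ a x
  have hsub : HasFDerivAt (fun y : E2 => y - a) (ContinuousLinearMap.id ℝ E2) x :=
    (hasFDerivAt_id x).sub_const a
  have h1 : HasFDerivAt (fun y : E2 => ρ ^ 2 + ‖y - a‖ ^ 2)
      (2 • (innerSL ℝ (x - a)).comp (ContinuousLinearMap.id ℝ E2)) x :=
    hsub.norm_sq.const_add _
  have h2 := ((hasDerivAt_inv hq0.ne').comp_hasFDerivAt x h1).const_mul (2 * ρ)
  have h3 : HasFDerivAt (fun y : E2 => rotateL R (negPlane (y - a) + ρ • e3))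
      ((rotateL R).comp (negPlane.comp (ContinuousLinearMap.id ℝ E2))) x :=
    (rotateL R).hasFDerivAt.comp x ((negPlane.hasFDerivAt.comp x hsub).add_const _)
  have h4 := h2.smul h3
  have hval : partialDeriv i (bpTail R ρ a) x = (2 * ρ * q⁻¹) • rotateL R (negPlane e) +
      (2 * ρ * (-(q ^ 2)⁻¹ * (2 * inner ℝ (x - a) e))) • A := by
    rw [partialDeriv, hfun]
    erw [h4.fderiv]
    simp [← hq, ← he]
    simp only [hA, inner_sub_left, map_add, map_sub, map_smul]
    module
  have hin : |inner ℝ (x - a) e| ≤ ‖A‖ := by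
    have := abs_real_inner_le_norm (x - a) e
    rw [hen, mul_one] at this
    refine this.trans (abs_le_of_sq_le_sq' ?_ (norm_nonneg _)).2
    rw [hAn, hq]; nlinarith
  rw [hval]
  refine (norm_add_le _ _).trans ?_
  rw [norm_smul, norm_smul, rotateL_apply, norm_rotate, norm_negPlane, hen]
  simp only [Real.norm_eq_abs, abs_mul, abs_neg, abs_inv, abs_pow, abs_of_pos hq0, abs_of_pos hρ,
    abs_two]
  have : 2 * ρ * ((q ^ 2)⁻¹ * (2 * |inner ℝ (x - a) e|)) * ‖A‖ ≤
      2 * ρ * ((q ^ 2)⁻¹ * (2 * ‖A‖)) * ‖A‖ := by gcongr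
  have h5 : 2 * ρ * ((q ^ 2)⁻¹ * (2 * ‖A‖)) * ‖A‖ = 4 * ρ * q⁻¹ := by
    rw [show 2 * ρ * ((q ^ 2)⁻¹ * (2 * ‖A‖)) * ‖A‖ = 4 * ρ * (q ^ 2)⁻¹ * ‖A‖ ^ 2 by ring, hAn]
    field_simp
  calc _ ≤ 2 * ρ * q⁻¹ * 1 + 4 * ρ * q⁻¹ := by linarith
    _ = 6 * ρ / q := by ring

/-! ### A Poincaré inequality and the cutoff -/

theorem norm_fderiv_le_sum_partialDeriv (h : E2 → E3) (x : E2) :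
    ‖fderiv ℝ h x‖ ≤ ∑ i, ‖partialDeriv i h x‖ := by
  refine ContinuousLinearMap.opNorm_le_bound _ (by positivity) fun z => ?_
  have hz : z = ∑ i, z i • (EuclideanSpace.single i (1 : ℝ) : E2) := by
    ext j; fin_cases j <;> simp
  conv_lhs => rw [hz]
  rw [map_sum, Finset.sum_mul]
  refine (norm_sum_le _ _).trans (Finset.sum_le_sum fun i _ => ?_)
  rw [map_smul, norm_smul, mul_comm]
  exact mul_le_mul_of_nonneg_left (PiLp.norm_apply_le z i) (norm_nonneg _)

theorem eLpNorm_fderiv_one_le {s : Set E2} {h : E2 → E3} (hd : ContDiff ℝ 1 h)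
    (hsupp : tsupport h ⊆ s) :
    eLpNorm (fderiv ℝ h) 1 volume ≤
      (∑ i, eLpNorm (partialDeriv i h) 2 (volume.restrict s)) * volume s ^ (1 / 2 : ℝ) := by
  have hcont : Continuous (fderiv ℝ h) := hd.continuous_fderiv one_ne_zero
  have hpd : ∀ i, Continuous (partialDeriv i h) := fun i => hcont.clm_apply continuous_const
  have h2 : eLpNorm (fderiv ℝ h) 1 volume = eLpNorm (fderiv ℝ h) 1 (volume.restrict s) := by
    have hsub : Function.support (fun x => ‖fderiv ℝ h x‖) ⊆ s := fun x hx =>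
      hsupp (support_fderiv_subset ℝ (fun h0 => hx (by simp [h0])))
    rw [← eLpNorm_norm, ← eLpNorm_restrict_eq_of_support_subset hsub, eLpNorm_norm]
  have h3 : eLpNorm (fderiv ℝ h) 1 (volume.restrict s) ≤
      eLpNorm (fderiv ℝ h) 2 (volume.restrict s) * volume s ^ (1 / 2 : ℝ) := by
    have := eLpNorm_le_eLpNorm_mul_rpow_measure_univ (μ := volume.restrict s) (f := fderiv ℝ h)
      (p := 1) (q := 2) (by norm_num) hcont.aestronglyMeasurable
    rw [Measure.restrict_apply_univ] at this
    rwa [show (1 / (1 : ℝ≥0∞).toReal - 1 / (2 : ℝ≥0∞).toReal : ℝ) = 1 / 2 by norm_num] at this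
  have h4 : eLpNorm (fderiv ℝ h) 2 (volume.restrict s) ≤
      ∑ i, eLpNorm (partialDeriv i h) 2 (volume.restrict s) := by
    calc _ ≤ eLpNorm (∑ i, fun x => ‖partialDeriv i h x‖) 2 (volume.restrict s) := by
          refine eLpNorm_mono_real fun x => ?_
          rw [Finset.sum_apply]
          exact norm_fderiv_le_sum_partialDeriv h x
      _ ≤ ∑ i, eLpNorm (fun x => ‖partialDeriv i h x‖) 2 (volume.restrict s) :=
          eLpNorm_sum_le (fun i _ => (hpd i).norm.aestronglyMeasurable) (by norm_num)
      _ = _ := by simp only [eLpNorm_norm]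
  rw [h2]
  exact h3.trans (mul_le_mul_left h4 _)

/-- Poincaré inequality in the plane: by the Gagliardo-Nirenberg-Sobolev inequality the `L²` norm is
bounded by the `L¹` norm of the gradient, which Hölder's inequality compares with its `L²` norm. -/
theorem exists_eLpNorm_le_sum_partialDeriv {s : Set E2} (hs : volume s ≠ ⊤) :
    ∃ C : ℝ≥0, ∀ h : E2 → E3, ContDiff ℝ 1 h → HasCompactSupport h → tsupport h ⊆ s →
      eLpNorm h 2 volume ≤ C * ∑ i, eLpNorm (partialDeriv i h) 2 (volume.restrict s) := by
  have hp : NNReal.HolderConjugate (Module.finrank ℝ E2 : ℝ≥0) 2 := by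
    rw [finrank_euclideanSpace_fin, NNReal.holderConjugate_iff]
    norm_num
  obtain ⟨K, hK⟩ : ∃ K : ℝ≥0, ∀ h : E2 → E3, ContDiff ℝ 1 h → HasCompactSupport h →
      eLpNorm h 2 volume ≤ K * eLpNorm (fderiv ℝ h) 1 volume :=
    ⟨_, fun h hd hc => by
      have := eLpNorm_le_eLpNorm_fderiv_one (volume : Measure E2) hd hc hp
      rwa [ENNReal.coe_ofNat] at this⟩
  refine ⟨K * (volume s).toNNReal ^ (1 / 2 : ℝ), fun h hd hc hsupp => ?_⟩
  have hvs : ((volume s).toNNReal ^ (1 / 2 : ℝ) : ℝ≥0) = volume s ^ (1 / 2 : ℝ) := by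
    rw [ENNReal.coe_rpow_of_nonneg _ (by norm_num), ENNReal.coe_toNNReal hs]
  refine (hK h hd hc).trans ?_
  rw [ENNReal.coe_mul, hvs, mul_assoc, mul_comm (volume s ^ (1 / 2 : ℝ))]
  exact mul_le_mul_right (eLpNorm_fderiv_one_le hd hsupp) _

/-- A cutoff equal to `1` on `Ω` removes from the profile tail centred in `Ω` only a part whose
gradient is of the order of the radius. -/
theorem exists_cutoff {Ω : Set E2} (hb : Bornology.IsBounded Ω) :
    ∃ (χ : E2 → ℝ) (C : ℝ≥0), ContDiff ℝ ∞ χ ∧ HasCompactSupport χ ∧ (∀ x ∈ Ω, χ x = 1) ∧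
      ∀ (R : SO3) (ρ : ℝ) (a : E2), 0 < ρ → a ∈ Ω → ∀ (i : Fin 2) (x : E2),
        ‖partialDeriv i (fun y => (1 - χ y) • bpTail R ρ a y) x‖ ≤ C * ρ := by
  obtain ⟨D, hD, hΩ⟩ := hb.subset_ball_lt 0 0
  let χ : ContDiffBump (0 : E2) := ⟨D + 1, D + 2, by linarith, by linarith⟩
  have hχc : ContDiff ℝ ∞ χ := χ.contDiff
  have hχs : HasCompactSupport χ := χ.hasCompactSupport
  obtain ⟨K, hK⟩ := (hχs.fderiv (𝕜 := ℝ)).exists_bound_of_continuous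
    (hχc.continuous_fderiv (by simp))
  have hK0 : 0 ≤ K := (norm_nonneg _).trans (hK 0)
  refine ⟨χ, ⟨2 * K + 6, by linarith⟩, hχc, hχs, fun x hx => ?_, ?_⟩
  · refine χ.one_of_mem_closedBall ?_
    have := hΩ hx
    simp only [Metric.mem_ball, Metric.mem_closedBall] at this ⊢
    change dist x 0 ≤ D + 1
    linarith
  intro R ρ a hρ ha i x
  change _ ≤ (2 * K + 6) * ρ
  have ha' : ‖a‖ < D := by simpa using hΩ ha
  by_cases hx : ‖x‖ < D + 1
  · -- near such a point the cutoff is identically `1`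
    have hev : (fun y => (1 - χ y) • bpTail R ρ a y) =ᶠ[𝓝 x] fun _ => 0 := by
      have : ∀ᶠ y in 𝓝 x, ‖y‖ < D + 1 := continuous_norm.continuousAt.eventually_lt_const hx
      filter_upwards [this] with y hy
      have : χ y = 1 := χ.one_of_mem_closedBall (by
        rw [Metric.mem_closedBall, dist_zero_right]; exact hy.le)
      rw [this]; simp
    rw [partialDeriv, hev.fderiv_eq]
    simp only [fderiv_fun_const, Pi.zero_apply, _root_.zero_apply, norm_zero]
    positivity
  · have hxa : 1 ≤ ‖x - a‖ := by
      have := norm_sub_norm_le x a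
      linarith
    have hq : 1 ≤ ρ ^ 2 + ‖x - a‖ ^ 2 := by nlinarith [sq_nonneg ρ]
    have h1 : ‖bpTail R ρ a x‖ ≤ 2 * ρ := by
      refine (abs_le_of_sq_le_sq' ?_ (by positivity)).2
      rw [norm_sq_bpTail R hρ, div_le_iff₀ (by linarith)]
      nlinarith [sq_nonneg ρ]
    have h2 : ‖partialDeriv i (bpTail R ρ a) x‖ ≤ 6 * ρ :=
      (norm_partialDeriv_bpTail_le R hρ a x i).trans (div_le_self (by positivity) hq)
    have hdχ : DifferentiableAt ℝ χ x := (hχc.differentiable (by simp)).differentiableAt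
    have hdψ : DifferentiableAt ℝ (bpTail R ρ a) x :=
      ((contDiff_bpTail R hρ a (n := 1)).differentiable one_ne_zero).differentiableAt
    have h3 : partialDeriv i (fun y => (1 - χ y) • bpTail R ρ a y) x =
        (1 - χ x) • partialDeriv i (bpTail R ρ a) x - partialDeriv i χ x • bpTail R ρ a x := by
      simp only [partialDeriv]
      rw [fderiv_fun_smul (hdχ.const_sub 1) hdψ, fderiv_const_sub]
      simp [sub_eq_add_neg]
    have h4 : ‖partialDeriv i χ x‖ ≤ K := by
      refine (ContinuousLinearMap.le_opNorm _ _).trans ?_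
      simpa using hK x
    rw [h3]
    refine (norm_sub_le _ _).trans ?_
    rw [norm_smul, norm_smul]
    have h5 : ‖1 - χ x‖ ≤ 1 := by
      rw [Real.norm_eq_abs, abs_le]
      constructor <;> linarith [χ.nonneg (x := x), χ.le_one (x := x)]
    calc _ ≤ 1 * (6 * ρ) + K * (2 * ρ) := by gcongr
      _ = (2 * K + 6) * ρ := by ring

/-! ### Comparison of an admissible map with a profile -/

theorem bpMap_eq_bpTail_sub (R : SO3) (ρ : ℝ) (a : E2) :
    bpMap R ρ a = fun x => bpTail R ρ a x - rotate R e3 := by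
  ext1 x; simp [bpTail]

theorem partialDeriv_bpMap (R : SO3) (ρ : ℝ) (a : E2) (i : Fin 2) :
    partialDeriv i (bpMap R ρ a) = partialDeriv i (bpTail R ρ a) := by
  ext1 x
  rw [bpMap_eq_bpTail_sub]
  simp only [partialDeriv, fderiv_sub_const]

theorem contDiff_bpMap (R : SO3) {ρ : ℝ} (hρ : 0 < ρ) (a : E2) {n : WithTop ℕ∞} :
    ContDiff ℝ n (bpMap R ρ a) := by
  rw [bpMap_eq_bpTail_sub]
  exact (contDiff_bpTail R hρ a).sub contDiff_const

/-- The weak gradient of `m - φ` on the plane is the extension by zero of the one of `m` in `Ω`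
minus the classical gradient of the profile: extension by zero is harmless because `m + e₃` is an
`H¹` limit of test functions in `Ω`. -/
theorem Admissible.hasWeakPartial_sub_bpMap {Ω : Set E2} (hΩ : IsOpen Ω) {m : E2 → E3}
    (hm : Admissible Ω m) (R : SO3) {ρ : ℝ} (hρ : 0 < ρ) (a : E2) (i : Fin 2) :
    HasWeakPartial Set.univ i (fun y => m y - bpMap R ρ a y)
      (fun x => Ω.indicator (weakPartial Ω i (fun y => m y + e3)) x -
        partialDeriv i (bpTail R ρ a) x) := by
  obtain ⟨v, hv, hv0, hv1⟩ := hm.boundary.exists_approx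
  have hf : MemLp (fun x => m x + e3) 2 (volume.restrict Ω) := hm.boundary.memH1.memLp
  have hg := hm.boundary.memH1.memLp_weakPartial hΩ i
  have hfind : (fun x => m x + e3) = Ω.indicator (fun x => m x + e3) := by
    refine (Set.indicator_eq_self.2 fun x hx => ?_).symm
    by_contra hx'
    exact hx (by simp [hm.eq_outside x hx'])
  have hfL : MemLp (fun x => m x + e3) 2 volume := by
    rw [hfind]; exact (memLp_indicator_iff_restrict hΩ.measurableSet).2 hf
  have hgL := (memLp_indicator_iff_restrict hΩ.measurableSet).2 hg
  have hone : (1 : ℝ≥0∞) ≤ 2 := by norm_num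
  have hψc : Continuous (partialDeriv i (bpTail R ρ a)) :=
    ((contDiff_bpTail R hρ a (n := 1)).continuous_fderiv one_ne_zero).clm_apply continuous_const
  refine hasWeakPartial_univ_of_tendsto (W := fun k x => v k x - (bpMap R ρ a x + e3))
    (fun k => ((hv k).1.of_le (by simp)).sub ((contDiff_bpMap R hρ a).add contDiff_const))
    ?_ ?_ ?_ ?_
  · have h := (hfL.locallyIntegrable hone).sub
      (((contDiff_bpMap R hρ a (n := 0)).continuous.add
        (continuous_const (y := e3))).locallyIntegrable (μ := volume))
    refine h.congr (Eventually.of_forall fun x => ?_)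
    simp
  · exact (hgL.locallyIntegrable hone).sub hψc.locallyIntegrable
  · convert hv0 using 2 with k
    rw [← eLpNorm_indicator_eq_eLpNorm_restrict hΩ.measurableSet]
    congr 1
    ext1 x
    by_cases hx : x ∈ Ω
    · rw [Set.indicator_of_mem hx]; abel
    · have hvx : v k x = 0 := image_eq_zero_of_notMem_tsupport fun h => hx ((hv k).2.2 h)
      rw [Set.indicator_of_notMem hx, hvx, hm.eq_outside x hx]; abel
  · convert hv1 i using 2 with k
    rw [← eLpNorm_indicator_eq_eLpNorm_restrict hΩ.measurableSet]
    congr 1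
    ext1 x
    have hd : partialDeriv i (fun x => v k x - (bpMap R ρ a x + e3)) x =
        partialDeriv i (v k) x - partialDeriv i (bpTail R ρ a) x := by
      rw [← partialDeriv_bpMap]
      simp only [partialDeriv]
      rw [fderiv_fun_sub ((hv k).1.differentiable (by simp)).differentiableAt
        (((contDiff_bpMap R hρ a (n := 1)).differentiable one_ne_zero).differentiableAt.add_const _),
        fderiv_add_const]
      rfl
    rw [hd]
    by_cases hx : x ∈ Ω
    · rw [Set.indicator_of_mem hx, Set.indicator_of_mem hx]; abel
    · have hvx : partialDeriv i (v k) x = 0 := by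
        rw [partialDeriv, fderiv_of_notMem_tsupport ℝ fun h => hx ((hv k).2.2 h)]; rfl
      rw [Set.indicator_of_notMem hx, Set.indicator_of_notMem hx, hvx]; abel

theorem eLpNorm_le_dirichletDistSq {Ω : Set E2} (hΩ : IsOpen Ω) {m : E2 → E3}
    (hm : Admissible Ω m) (R : SO3) {ρ : ℝ} (hρ : 0 < ρ) (a : E2) (i : Fin 2) :
    eLpNorm (fun x => Ω.indicator (weakPartial Ω i (fun y => m y + e3)) x -
        partialDeriv i (bpTail R ρ a) x) 2 volume ≤
      dirichletDistSq m (bpMap R ρ a) ^ (1 / 2 : ℝ) := by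
  have h := (hm.hasWeakPartial_sub_bpMap hΩ R hρ a i).weakPartial_ae_eq isOpen_univ
  rw [Measure.restrict_univ] at h
  rw [← eLpNorm_congr_ae h, eLpNorm_eq_lintegral_rpow_enorm_toReal (by norm_num) (by norm_num)]
  simp only [ENNReal.toReal_ofNat, ENNReal.rpow_ofNat, dirichletDistSq]
  gcongr with x
  exact Finset.single_le_sum (f := fun j => ‖weakPartial Set.univ j
    (fun y => m y - bpMap R ρ a y) x‖ₑ ^ 2) (fun _ _ => zero_le) (Finset.mem_univ i)

/-- An admissible map differs from a profile (up to the rotation of the limit at infinity) in `L²`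
by at most a multiple of the Dirichlet distance plus the radius. The difference does not vanish on the boundary
of `Ω`; the Poincaré inequality is applied after cutting off the tail of the profile. -/
theorem exists_eLpNorm_sub_bpTail_le {Ω : Set E2} (hΩ : IsOpen Ω) (hb : Bornology.IsBounded Ω) :
    ∃ C : ℝ≥0, ∀ m : E2 → E3, Admissible Ω m → ∀ (R : SO3) (ρ : ℝ) (a : E2), 0 < ρ → a ∈ Ω →
      eLpNorm (fun x => m x + e3 - bpTail R ρ a x) 2 (volume.restrict Ω) ≤
        C * (dirichletDistSq m (bpMap R ρ a) ^ (1 / 2 : ℝ) + ENNReal.ofReal ρ) := by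
  obtain ⟨χ, K, hχ, hχs, hχ1, hcut⟩ := exists_cutoff hb
  obtain ⟨D, hD⟩ := (hb.union hχs.isBounded).subset_closedBall 0
  set B : Set E2 := Metric.closedBall 0 D
  have hBfin : volume B ≠ ⊤ := measure_closedBall_lt_top.ne
  obtain ⟨P, hP⟩ := exists_eLpNorm_le_sum_partialDeriv hBfin
  set V : ℝ≥0 := (volume B).toNNReal ^ (1 / 2 : ℝ) with hV
  refine ⟨2 * P * (1 + K * V), fun m hm R ρ a hρ ha => ?_⟩
  obtain ⟨v, hv, hv0, hv1⟩ := hm.boundary.exists_approx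
  have hf : MemLp (fun x => m x + e3) 2 (volume.restrict Ω) := hm.boundary.memH1.memLp
  set ψ := bpTail R ρ a
  have hψs : ContDiff ℝ 1 ψ := contDiff_bpTail R hρ a
  set δ : ℝ≥0∞ := dirichletDistSq m (bpMap R ρ a) ^ (1 / 2 : ℝ)
  set f : E2 → E3 := fun x => m x + e3
  have hχ' : ContDiff ℝ 1 χ := hχ.of_le (by simp)
  have hv' : ∀ k, ContDiff ℝ 1 (v k) := fun k => (hv k).1.of_le (by simp)
  let h : ℕ → E2 → E3 := fun k x => v k x - χ x • ψ x
  have hhd : ∀ k, ContDiff ℝ 1 (h k) := fun k => (hv' k).sub (hχ'.smul hψs)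
  have hsub : ∀ k, tsupport (h k) ⊆ B := by
    intro k
    refine closure_minimal (fun x hx => ?_) Metric.isClosed_closedBall
    by_contra hxB
    have h1 : v k x = 0 := image_eq_zero_of_notMem_tsupport fun h0 =>
      hxB (hD (Or.inl ((hv k).2.2 h0)))
    have h2 : χ x = 0 := image_eq_zero_of_notMem_tsupport fun h0 => hxB (hD (Or.inr h0))
    exact hx (by simp [h, h1, h2])
  have hcs : ∀ k, HasCompactSupport (h k) := fun k =>
    HasCompactSupport.of_support_subset_isCompact (isCompact_closedBall 0 D)
      ((subset_tsupport _).trans (hsub k))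
  have hgm : ∀ i, AEStronglyMeasurable (Ω.indicator (weakPartial Ω i f)) volume := fun i =>
    ((memLp_indicator_iff_restrict hΩ.measurableSet).2
      (hm.boundary.memH1.memLp_weakPartial hΩ i)).1
  have hψd : ∀ i, Continuous (partialDeriv i ψ) := fun i =>
    (hψs.continuous_fderiv one_ne_zero).clm_apply continuous_const
  have hvd : ∀ k i, Continuous (partialDeriv i (v k)) := fun k i =>
    ((hv' k).continuous_fderiv one_ne_zero).clm_apply continuous_const
  let ε : ℕ → Fin 2 → ℝ≥0∞ := fun k i =>
    eLpNorm (fun x => partialDeriv i (v k) x - weakPartial Ω i f x) 2 (volume.restrict Ω)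
  have hpart : ∀ k i, eLpNorm (partialDeriv i (h k)) 2 (volume.restrict B) ≤
      ε k i + δ + K * V * ENNReal.ofReal ρ := by
    intro k i
    -- Split the gradient into the approximation error, the gradient of `m - φ`, and the part of the
    -- tail removed by the cutoff.
    set A₁ : E2 → E3 := fun x => partialDeriv i (v k) x - Ω.indicator (weakPartial Ω i f) x
    set A₂ : E2 → E3 := fun x => Ω.indicator (weakPartial Ω i f) x - partialDeriv i ψ x
    set A₃ : E2 → E3 := fun x => partialDeriv i (fun y => (1 - χ y) • ψ y) x
    have hsum : partialDeriv i (h k) = A₁ + A₂ + A₃ := by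
      have hh : h k = fun x => v k x - ψ x + (1 - χ x) • ψ x := by
        ext1 x; simp only [h, sub_smul, one_smul]; abel
      have d1 : ∀ x, DifferentiableAt ℝ (v k) x := (hv' k).differentiable one_ne_zero
      have d2 : ∀ x, DifferentiableAt ℝ ψ x := hψs.differentiable one_ne_zero
      have d3 : ∀ x, DifferentiableAt ℝ (fun y => (1 - χ y) • ψ y) x :=
        ((contDiff_const.sub hχ').smul hψs).differentiable one_ne_zero
      ext1 x
      simp only [Pi.add_apply, A₁, A₂, A₃]
      rw [hh]
      simp only [partialDeriv]
      rw [fderiv_fun_add ((d1 x).fun_sub (d2 x)) (d3 x), fderiv_fun_sub (d1 x) (d2 x)]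
      simp only [_root_.add_apply, _root_.sub_apply]
      abel
    have m1 : AEStronglyMeasurable A₁ volume := (hvd k i).aestronglyMeasurable.sub (hgm i)
    have m2 : AEStronglyMeasurable A₂ volume := (hgm i).sub (hψd i).aestronglyMeasurable
    have m3 : AEStronglyMeasurable A₃ volume :=
      ((((contDiff_const.sub hχ').smul hψs).continuous_fderiv one_ne_zero).clm_apply
        continuous_const).aestronglyMeasurable
    have b1 : eLpNorm A₁ 2 (volume.restrict B) ≤ ε k i := by
      refine (eLpNorm_mono_measure _ Measure.restrict_le_self).trans (le_of_eq ?_)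
      change _ = eLpNorm (fun x => partialDeriv i (v k) x - weakPartial Ω i f x) 2 _
      rw [← eLpNorm_indicator_eq_eLpNorm_restrict hΩ.measurableSet]
      congr 1
      ext1 x
      by_cases hx : x ∈ Ω
      · simp only [A₁, Set.indicator_of_mem hx]
      · have hvx : partialDeriv i (v k) x = 0 := by
          rw [partialDeriv, fderiv_of_notMem_tsupport ℝ fun h => hx ((hv k).2.2 h)]; rfl
        simp only [A₁, Set.indicator_of_notMem hx, hvx, sub_zero]
    have b2 : eLpNorm A₂ 2 (volume.restrict B) ≤ δ :=
      (eLpNorm_mono_measure _ Measure.restrict_le_self).trans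
        (eLpNorm_le_dirichletDistSq hΩ hm R hρ a i)
    have b3 : eLpNorm A₃ 2 (volume.restrict B) ≤ K * V * ENNReal.ofReal ρ := by
      refine (eLpNorm_le_of_ae_bound (C := K * ρ)
        (Eventually.of_forall fun x => hcut R ρ a hρ ha i x)).trans (le_of_eq ?_)
      rw [Measure.restrict_apply_univ, ENNReal.ofReal_mul K.coe_nonneg, ENNReal.ofReal_coe_nnreal, hV,
        ENNReal.coe_rpow_of_nonneg _ (by norm_num), ENNReal.coe_toNNReal hBfin,
        ENNReal.toReal_ofNat, one_div]
      ring
    rw [hsum]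
    calc _ ≤ eLpNorm A₁ 2 (volume.restrict B) + eLpNorm A₂ 2 (volume.restrict B) +
          eLpNorm A₃ 2 (volume.restrict B) :=
        (eLpNorm_add_le (m1.add m2).restrict m3.restrict (by norm_num)).trans
          (add_le_add_left (eLpNorm_add_le m1.restrict m2.restrict (by norm_num)) _)
      _ ≤ _ := add_le_add (add_le_add b1 b2) b3
  have hbound : ∀ k, eLpNorm (fun x => f x - ψ x) 2 (volume.restrict Ω) ≤
      eLpNorm (fun x => v k x - f x) 2 (volume.restrict Ω) +
        P * ∑ i, (ε k i + δ + K * V * ENNReal.ofReal ρ) := by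
    intro k
    have e1 : eLpNorm (fun x => f x - ψ x) 2 (volume.restrict Ω) =
        eLpNorm (h k - (fun x => v k x - f x)) 2 (volume.restrict Ω) := by
      refine eLpNorm_congr_ae ?_
      filter_upwards [ae_restrict_mem hΩ.measurableSet] with x hx
      simp only [h, Pi.sub_apply, hχ1 x hx, one_smul]
      abel
    rw [e1, add_comm]
    refine (eLpNorm_sub_le (hhd k).continuous.aestronglyMeasurable
      ((hv' k).continuous.aestronglyMeasurable.sub hf.1) (by norm_num)).trans ?_
    refine add_le_add_left ((eLpNorm_mono_measure _ Measure.restrict_le_self).trans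
      ((hP (h k) (hhd k) (hcs k) (hsub k)).trans ?_)) _
    gcongr with i
    exact hpart k i
  have hlim : Tendsto (fun k => eLpNorm (fun x => v k x - f x) 2 (volume.restrict Ω) +
        P * ∑ i, (ε k i + δ + K * V * ENNReal.ofReal ρ)) atTop
      (𝓝 (0 + P * ∑ _i : Fin 2, (0 + δ + K * V * ENNReal.ofReal ρ))) := by
    refine hv0.add (ENNReal.Tendsto.const_mul (tendsto_finsetSum _ fun i _ => ?_)
      (Or.inr ENNReal.coe_ne_top))
    exact ((hv1 i).add tendsto_const_nhds).add tendsto_const_nhds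
  refine (ge_of_tendsto' hlim hbound).trans ?_
  simp only [zero_add, Finset.sum_const, Finset.card_univ, Fintype.card_fin, nsmul_eq_mul]
  push_cast
  have : (P : ℝ≥0∞) * (2 * (δ + K * V * ENNReal.ofReal ρ)) =
      2 * P * (1 * δ + K * V * ENNReal.ofReal ρ) := by ring
  rw [this, mul_assoc (2 * (P : ℝ≥0∞))]
  gcongr
  rw [mul_add, add_mul, add_mul]
  refine add_le_add le_self_add ?_
  exact le_add_self

/-! ### Radial integrals -/

theorem setIntegral_ball_radial (a : E2) {d : ℝ} (hd : 0 ≤ d) (f : ℝ → ℝ) :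
    ∫ x in Metric.ball a d, f ‖x - a‖ = 2 * Real.pi * ∫ r in (0 : ℝ)..d, r * f r := by
  rw [← integral_indicator Metric.isOpen_ball.measurableSet]
  have h1 : (Metric.ball a d).indicator (fun x => f ‖x - a‖) =
      fun x => ((Set.Iio d).indicator f) ‖x - a‖ := by
    ext1 x
    simp only [Set.indicator, Metric.mem_ball, dist_eq_norm, Set.mem_Iio]
  rw [h1, integral_sub_right_eq_self (μ := volume) (fun x : E2 => ((Set.Iio d).indicator f) ‖x‖) a,
    integral_fun_norm_addHaar, intervalIntegral.integral_of_le hd]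
  have h2 : (fun y : ℝ => y ^ (Module.finrank ℝ E2 - 1) • (Set.Iio d).indicator f y) =
      (Set.Iio d).indicator fun y => y * f y := by
    ext1 y
    simp only [finrank_euclideanSpace_fin, Set.indicator]
    split_ifs <;> simp
  have h3 : (volume : Measure E2).real (Metric.ball 0 1) = Real.pi := by
    rw [Measure.real, EuclideanSpace.volume_ball_fin_two]
    simp [Real.pi_pos.le]
  rw [h2, h3, setIntegral_indicator measurableSet_Iio, finrank_euclideanSpace_fin,
    Set.Ioi_inter_Iio, integral_Ioc_eq_integral_Ioo]
  simp [mul_assoc]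

theorem setIntegral_ball_norm_sq_bpTail (R : SO3) {ρ : ℝ} (hρ : 0 < ρ) (a : E2) {d : ℝ}
    (hd : 0 ≤ d) :
    ∫ x in Metric.ball a d, ‖bpTail R ρ a x‖ ^ 2 =
      4 * Real.pi * ρ ^ 2 * (Real.log (ρ ^ 2 + d ^ 2) - 2 * Real.log ρ) := by
  simp only [norm_sq_bpTail R hρ]
  rw [setIntegral_ball_radial a hd fun r => 4 * ρ ^ 2 / (ρ ^ 2 + r ^ 2)]
  have hder : ∀ r ∈ Set.uIcc 0 d, HasDerivAt (fun r => 2 * ρ ^ 2 * Real.log (ρ ^ 2 + r ^ 2))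
      (r * (4 * ρ ^ 2 / (ρ ^ 2 + r ^ 2))) r := by
    intro r _
    have hq : ρ ^ 2 + r ^ 2 ≠ 0 := by positivity
    refine ((((hasDerivAt_pow 2 r).const_add (ρ ^ 2)).log hq).const_mul (2 * ρ ^ 2)).congr_deriv ?_
    push_cast
    field_simp
    ring
  rw [intervalIntegral.integral_eq_sub_of_hasDerivAt hder]
  · have : Real.log (ρ ^ 2 + 0 ^ 2) = 2 * Real.log ρ := by
      rw [zero_pow two_ne_zero, add_zero, Real.log_pow]; norm_num
    rw [this]; ring
  · refine Continuous.intervalIntegrable ?_ _ _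
    exact continuous_id.mul (continuous_const.div (by fun_prop) fun r => by positivity)

/-- The fourth power of the decay `ρ / |x - a|` is integrable at infinity: it contributes no
logarithm. -/
theorem setIntegral_ball_sq_le {ρ : ℝ} (hρ : 0 < ρ) (a : E2) {d : ℝ} (hd : 0 ≤ d) :
    ∫ x in Metric.ball a d, (2 * ρ ^ 2 / (ρ ^ 2 + ‖x - a‖ ^ 2)) ^ 2 ≤ 4 * Real.pi * ρ ^ 2 := by
  rw [setIntegral_ball_radial a hd fun r => (2 * ρ ^ 2 / (ρ ^ 2 + r ^ 2)) ^ 2]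
  have hder : ∀ r ∈ Set.uIcc 0 d, HasDerivAt (fun r => -(2 * ρ ^ 4) * (ρ ^ 2 + r ^ 2)⁻¹)
      (r * (2 * ρ ^ 2 / (ρ ^ 2 + r ^ 2)) ^ 2) r := by
    intro r _
    have hq : ρ ^ 2 + r ^ 2 ≠ 0 := by positivity
    refine ((((hasDerivAt_pow 2 r).const_add (ρ ^ 2)).fun_inv hq).const_mul
      (-(2 * ρ ^ 4))).congr_deriv ?_
    push_cast
    field_simp
  rw [intervalIntegral.integral_eq_sub_of_hasDerivAt hder]
  · have h1 : 0 ≤ 2 * ρ ^ 4 * (ρ ^ 2 + d ^ 2)⁻¹ := by positivity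
    have h2 : 2 * ρ ^ 4 * (ρ ^ 2 + 0 ^ 2)⁻¹ = 2 * ρ ^ 2 := by field_simp; ring
    nlinarith [Real.pi_pos, mul_nonneg Real.pi_pos.le h1]
  · refine Continuous.intervalIntegrable ?_ _ _
    exact continuous_id.mul ((continuous_const.div (by fun_prop) fun r => by positivity).pow 2)

theorem tendsto_inv_abs_log {κ : ℕ → ℝ} (hκpos : ∀ n, 0 < κ n) (hκ : Tendsto κ atTop (𝓝 0)) :
    Tendsto (fun n => |Real.log (κ n)|⁻¹) atTop (𝓝 0) := by
  have h0 : Tendsto κ atTop (𝓝[>] 0) :=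
    tendsto_nhdsWithin_iff.2 ⟨hκ, Eventually.of_forall hκpos⟩
  exact (tendsto_abs_atBot_atTop.comp (Real.tendsto_log_nhdsGT_zero.comp h0)).inv_tendsto_atTop

/-- Asymptotics of the integral of the squared tail over a disc: the logarithm of the radius `ρ` is
asymptotic to that of the scale `κ`, whatever the radius `d` of the disc. -/
theorem tendsto_norm_sq_ball_ratio {κ ρ : ℕ → ℝ} {r₀ d : ℝ} (hκpos : ∀ n, 0 < κ n)
    (hκ : Tendsto κ atTop (𝓝 0)) (hρ : ∀ n, 0 < ρ n) (hr₀ : 0 < r₀)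
    (hlim : Tendsto (fun n => ρ n / κ n) atTop (𝓝 r₀)) (hd : 0 < d) :
    Tendsto (fun n => 4 * Real.pi * ρ n ^ 2 * (Real.log (ρ n ^ 2 + d ^ 2) - 2 * Real.log (ρ n)) /
      (κ n ^ 2 * |Real.log (κ n)|)) atTop (𝓝 (8 * Real.pi * r₀ ^ 2)) := by
  have hinv := tendsto_inv_abs_log hκpos hκ
  have hρ0 : Tendsto ρ atTop (𝓝 0) := by
    have := hlim.mul hκ
    rw [mul_zero] at this
    exact this.congr fun n => div_mul_cancel₀ _ (hκpos n).ne'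
  have hl1 : Tendsto (fun n => Real.log (ρ n ^ 2 + d ^ 2) - 2 * Real.log (ρ n / κ n)) atTop
      (𝓝 (Real.log (0 ^ 2 + d ^ 2) - 2 * Real.log r₀)) :=
    (((hρ0.pow 2).add_const _).log (by positivity)).sub ((hlim.log hr₀.ne').const_mul 2)
  have hl2 := (hl1.mul hinv).add_const 2
  have hl3 := ((hlim.pow 2).const_mul (4 * Real.pi)).mul hl2
  have hval : 4 * Real.pi * r₀ ^ 2 * ((Real.log (0 ^ 2 + d ^ 2) - 2 * Real.log r₀) * 0 + 2) =
      8 * Real.pi * r₀ ^ 2 := by ring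
  rw [hval] at hl3
  refine hl3.congr' ?_
  filter_upwards [hκ.eventually_lt_const one_pos] with n hn
  have hlneg : Real.log (κ n) < 0 := Real.log_neg (hκpos n) hn
  have hk := (hκpos n).ne'
  rw [Real.log_div (hρ n).ne' hk, abs_of_neg hlneg]
  have := hlneg.ne
  field_simp
  ring

/-! ### The in-plane part -/

/-- The projection `(m', m₃) ↦ m'`. -/
noncomputable def inPlane : E3 →L[ℝ] E2 :=
  LinearMap.toContinuousLinearMap
    { toFun := fun v => !₂[v 0, v 1]
      map_add' := fun u v => by ext i; fin_cases i <;> simp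
      map_smul' := fun c v => by ext i; fin_cases i <;> simp }

theorem inPlane_apply (v : E3) : inPlane v = !₂[v 0, v 1] := rfl

theorem norm_sq_inPlane (v : E3) : ‖inPlane v‖ ^ 2 = v 0 ^ 2 + v 1 ^ 2 := by
  rw [EuclideanSpace.real_norm_sq_eq]
  simp [Fin.sum_univ_two, inPlane_apply]

theorem norm_sq_eq_inPlane_add (v : E3) : ‖v‖ ^ 2 = ‖inPlane v‖ ^ 2 + v 2 ^ 2 := by
  rw [norm_sq_inPlane, EuclideanSpace.real_norm_sq_eq, Fin.sum_univ_three]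

theorem norm_inPlane_le (v : E3) : ‖inPlane v‖ ≤ ‖v‖ :=
  (abs_le_of_sq_le_sq' (by rw [norm_sq_eq_inPlane_add v]; nlinarith [sq_nonneg (v 2)])
    (norm_nonneg _)).2

theorem inPlaneSq_eq (m : E2 → E3) (x : E2) : inPlaneSq m x = ‖inPlane (m x)‖ ^ 2 :=
  (norm_sq_inPlane _).symm

theorem inPlane_e3 : inPlane e3 = 0 := by
  ext i; fin_cases i <;> simp [inPlane_apply, e3]

theorem integral_norm_sq_eq_lpNorm_sq {F : Type*} [NormedAddCommGroup F] {μ : Measure E2}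
    {f : E2 → F} (hf : AEStronglyMeasurable f μ) :
    ∫ x, ‖f x‖ ^ 2 ∂μ = lpNorm f 2 μ ^ 2 := by
  rw [lpNorm_eq_integral_norm_rpow_toReal (by norm_num) (by norm_num) hf]
  simp only [ENNReal.toReal_ofNat, Real.rpow_two]
  rw [← one_div, ← Real.sqrt_eq_rpow, Real.sq_sqrt (integral_nonneg fun x => by positivity)]

theorem norm_bpTail_le_two (R : SO3) {ρ : ℝ} (hρ : 0 < ρ) (a x : E2) : ‖bpTail R ρ a x‖ ≤ 2 := by
  refine (abs_le_of_sq_le_sq' ?_ (by norm_num)).2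
  rw [norm_sq_bpTail R hρ, div_le_iff₀ (by positivity)]
  nlinarith [sq_nonneg ‖x - a‖]

theorem memLp_bpTail (R : SO3) {ρ : ℝ} (hρ : 0 < ρ) (a : E2) (μ : Measure E2)
    [IsFiniteMeasure μ] : MemLp (bpTail R ρ a) 2 μ :=
  MemLp.of_bound (contDiff_bpTail R hρ a (n := 0)).continuous.aestronglyMeasurable 2
    (Eventually.of_forall fun x => norm_bpTail_le_two R hρ a x)

/-- Since `R` almost fixes the vertical axis, the vertical component of the tail is small compared
with the tail, up to a term without logarithmic divergence. -/
theorem sq_bpTail_two_le (R : SO3) {ρ : ℝ} (hρ : 0 < ρ) (a x : E2) :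
    bpTail R ρ a x 2 ^ 2 ≤
      2 * (|R.1 2 0| + |R.1 2 1|) ^ 2 * ‖bpTail R ρ a x‖ ^ 2 +
        2 * R.1 2 2 ^ 2 * (2 * ρ ^ 2 / (ρ ^ 2 + ‖x - a‖ ^ 2)) ^ 2 := by
  set w : E3 := bpProfile (ρ⁻¹ • (x - a)) + e3 with hw
  have hψ : bpTail R ρ a x = rotate R w := by
    rw [hw, ← rotateL_apply, map_add]; rfl
  have hn : ‖bpTail R ρ a x‖ = ‖w‖ := by rw [hψ, norm_rotate]
  have h2 : w 2 = 2 * ρ ^ 2 / (ρ ^ 2 + ‖x - a‖ ^ 2) := by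
    rw [hw, bpProfile_smul_add_e3 hρ]
    simp [negPlane_apply, e3]
    ring
  have hc : bpTail R ρ a x 2 = R.1 2 0 * w 0 + R.1 2 1 * w 1 + R.1 2 2 * w 2 := by
    rw [hψ]
    simp [rotate, Matrix.mulVec, dotProduct, Fin.sum_univ_three]
  have hA : |R.1 2 0 * w 0 + R.1 2 1 * w 1| ≤ (|R.1 2 0| + |R.1 2 1|) * ‖w‖ := by
    refine (abs_add_le _ _).trans ?_
    rw [abs_mul, abs_mul, add_mul]
    gcongr
    · exact PiLp.norm_apply_le w 0
    · exact PiLp.norm_apply_le w 1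
  have hA2 := sq_le_sq' (abs_le.1 hA).1 (abs_le.1 hA).2
  rw [hc, ← h2, hn]
  nlinarith [sq_nonneg (R.1 2 0 * w 0 + R.1 2 1 * w 1 - R.1 2 2 * w 2)]

theorem rotation_bottom_row {R : SO3} (h : rotate R e3 = e3) (j : Fin 3) :
    R.1 2 j = if j = 2 then 1 else 0 := by
  have hcol : ∀ k, R.1 k 2 = if k = 2 then 1 else 0 := fun k => by
    have := congrArg (fun v : E3 => v k) h
    simpa [rotate, e3, Matrix.mulVec, dotProduct, Pi.single_apply] using this
  have hR : (R.1)ᵀ * R.1 = 1 :=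
    (Matrix.mem_orthogonalGroup_iff' _ _).1 (Matrix.mem_specialOrthogonalGroup_iff.1 R.2).1
  have := congrFun (congrFun hR 2) j
  simp only [Matrix.mul_apply, Matrix.transpose_apply, hcol, Fin.sum_univ_three] at this
  simpa [Matrix.one_apply, eq_comm] using this

theorem tendsto_bottom_row {R : ℕ → SO3} {R₀ : SO3} (hR : Tendsto R atTop (𝓝 R₀))
    (h : rotate R₀ e3 = e3) (j : Fin 3) :
    Tendsto (fun n => (R n).1 2 j) atTop (𝓝 (if j = 2 then 1 else 0)) := by
  rw [← rotation_bottom_row h j]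
  have h1 : Continuous fun A : SO3 => A.1 2 j :=
    (continuous_apply j).comp ((continuous_apply 2).comp continuous_subtype_val)
  exact (h1.tendsto R₀).comp hR

theorem exists_subset_ball_of_mem {Ω : Set E2} (hb : Bornology.IsBounded Ω) :
    ∃ D : ℝ, 0 < D ∧ ∀ a ∈ Ω, Ω ⊆ Metric.ball a D := by
  obtain ⟨D, hD, hDΩ⟩ := hb.subset_ball_lt 0 0
  refine ⟨2 * D, by positivity, fun a ha x hx => ?_⟩
  have h1 : ‖x‖ < D := by simpa using hDΩ hx
  have h2 : ‖a‖ < D := by simpa using hDΩ ha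
  rw [Metric.mem_ball, dist_eq_norm]
  linarith [norm_sub_le x a]

/-- The `L²` norm of the tail, sandwiched between two concentric balls: its logarithmic divergence
does not see the shape of the domain. -/
theorem tendsto_integral_norm_sq_bpTail {Ω : Set E2} (hΩ : IsOpen Ω)
    (hb : Bornology.IsBounded Ω) {κ ρ : ℕ → ℝ} {R : ℕ → SO3} {a : ℕ → E2} {r₀ : ℝ} {a₀ : E2}
    (hκpos : ∀ n, 0 < κ n) (hκ : Tendsto κ atTop (𝓝 0)) (hρ : ∀ n, 0 < ρ n) (hr₀ : 0 < r₀)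
    (ha₀ : a₀ ∈ Ω) (haΩ : ∀ n, a n ∈ Ω)
    (hlim : Tendsto (fun n => ρ n / κ n) atTop (𝓝 r₀)) (ha : Tendsto a atTop (𝓝 a₀)) :
    Tendsto (fun n => (∫ x in Ω, ‖bpTail (R n) (ρ n) (a n) x‖ ^ 2) / (κ n ^ 2 * |Real.log (κ n)|))
      atTop (𝓝 (8 * Real.pi * r₀ ^ 2)) := by
  obtain ⟨d, hd, hdΩ⟩ := Metric.isOpen_iff.1 hΩ a₀ ha₀
  obtain ⟨D, hD, hΩD⟩ := exists_subset_ball_of_mem hb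
  have hin : ∀ (n : ℕ) (r : ℝ), IntegrableOn (fun x => ‖bpTail (R n) (ρ n) (a n) x‖ ^ 2)
      (Metric.ball (a n) r) := fun n r => by
    have : IsFiniteMeasure (volume.restrict (Metric.ball (a n) r)) :=
      ⟨by rw [Measure.restrict_apply_univ]; exact measure_ball_lt_top⟩
    exact (memLp_bpTail (R n) (hρ n) (a n) _).integrable_norm_pow (by norm_num)
  have hsub2 : ∀ n, Ω ⊆ Metric.ball (a n) D := fun n => hΩD (a n) (haΩ n)
  refine tendsto_of_tendsto_of_tendsto_of_le_of_le'
    (tendsto_norm_sq_ball_ratio hκpos hκ hρ hr₀ hlim (half_pos hd))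
    (tendsto_norm_sq_ball_ratio hκpos hκ hρ hr₀ hlim hD) ?_ ?_
  · filter_upwards [ha (Metric.ball_mem_nhds a₀ (half_pos hd))] with n hn
    have hsub : Metric.ball (a n) (d / 2) ⊆ Ω :=
      (Metric.ball_subset_ball' (by
        have : dist (a n) a₀ < d / 2 := hn
        linarith)).trans hdΩ
    rw [← setIntegral_ball_norm_sq_bpTail (R n) (hρ n) (a n) (half_pos hd).le]
    gcongr
    · exact Eventually.of_forall fun x => sq_nonneg _
    · exact (hin n D).mono_set (hsub2 n)
  · refine Eventually.of_forall fun n => ?_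
    rw [← setIntegral_ball_norm_sq_bpTail (R n) (hρ n) (a n) hD.le]
    gcongr
    · exact Eventually.of_forall fun x => sq_nonneg _
    · exact hin n _
    · exact hsub2 n

/-! ### The limit of the anisotropy -/

theorem memLp_inPlane {μ : Measure E2} {f : E2 → E3} (hf : MemLp f 2 μ) :
    MemLp (fun x => inPlane (f x)) 2 μ :=
  inPlane.comp_memLp' hf

theorem abs_lpNorm_inPlane_sub_le {μ : Measure E2} {f g : E2 → E3} (hf : MemLp f 2 μ)
    (hg : MemLp g 2 μ) :
    |lpNorm (fun x => inPlane (f x)) 2 μ - lpNorm (fun x => inPlane (g x)) 2 μ| ≤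
      lpNorm (fun x => f x - g x) 2 μ := by
  have hF := memLp_inPlane hf
  have hG := memLp_inPlane hg
  have hfg : MemLp (fun x => f x - g x) 2 μ := hf.sub hg
  have hle : lpNorm ((fun x => inPlane (f x)) - fun x => inPlane (g x)) 2 μ ≤
      lpNorm (fun x => f x - g x) 2 μ := by
    rw [← lpNorm_norm hfg.1]
    refine lpNorm_mono_real hfg.norm fun x => ?_
    rw [Pi.sub_apply, ← map_sub]
    exact norm_inPlane_le _
  have h1 := lpNorm_le_lpNorm_add_lpNorm_sub' (f := fun x => inPlane (f x)) hG
    (by norm_num : (1 : ℝ≥0∞) ≤ 2)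
  have h2 := lpNorm_le_lpNorm_add_lpNorm_sub (f := fun x => inPlane (g x)) hF
    (by norm_num : (1 : ℝ≥0∞) ≤ 2)
  rw [abs_le]
  constructor <;> linarith

/-- The scale factor `κ² |log κ|` of the anisotropy. -/
noncomputable def logScale (κ : ℝ) : ℝ := κ ^ 2 * |Real.log κ|

theorem isFiniteMeasure_restrict_of_isBounded {Ω : Set E2} (hb : Bornology.IsBounded Ω) :
    IsFiniteMeasure (volume.restrict Ω) :=
  ⟨by rw [Measure.restrict_apply_univ]; exact hb.measure_lt_top⟩

/-- The vertical component of the tail does not contribute at the scale `κ² |log κ|`. -/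
theorem tendsto_integral_norm_sq_inPlane_bpTail {Ω : Set E2} (hΩ : IsOpen Ω)
    (hb : Bornology.IsBounded Ω) {κ ρ : ℕ → ℝ} {R : ℕ → SO3} {a : ℕ → E2} {R₀ : SO3} {r₀ : ℝ}
    {a₀ : E2} (hκpos : ∀ n, 0 < κ n) (hκ : Tendsto κ atTop (𝓝 0)) (hρ : ∀ n, 0 < ρ n)
    (h₀ : LimitAdmissible Ω R₀ r₀ a₀) (haΩ : ∀ n, a n ∈ Ω) (hR : Tendsto R atTop (𝓝 R₀))
    (hlim : Tendsto (fun n => ρ n / κ n) atTop (𝓝 r₀)) (ha : Tendsto a atTop (𝓝 a₀)) :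
    Tendsto (fun n => (∫ x in Ω, ‖inPlane (bpTail (R n) (ρ n) (a n) x)‖ ^ 2) / logScale (κ n))
      atTop (𝓝 (8 * Real.pi * r₀ ^ 2)) := by
  have := isFiniteMeasure_restrict_of_isBounded hb
  have hT := tendsto_integral_norm_sq_bpTail hΩ hb (R := R) hκpos hκ hρ h₀.pos h₀.mem haΩ hlim ha
  have hL : ∀ n, 0 ≤ logScale (κ n) := fun n => by unfold logScale; positivity
  have hmem : ∀ n, MemLp (bpTail (R n) (ρ n) (a n)) 2 (volume.restrict Ω) := fun n =>
    memLp_bpTail (R n) (hρ n) (a n) _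
  have hi1 : ∀ n, Integrable (fun x => ‖bpTail (R n) (ρ n) (a n) x‖ ^ 2) (volume.restrict Ω) :=
    fun n => (hmem n).integrable_norm_pow (by norm_num)
  have hi2 : ∀ n, Integrable (fun x => ‖inPlane (bpTail (R n) (ρ n) (a n) x)‖ ^ 2)
      (volume.restrict Ω) :=
    fun n => (memLp_inPlane (hmem n)).integrable_norm_pow (by norm_num)
  have hsplit : ∀ n, ∫ x in Ω, ‖inPlane (bpTail (R n) (ρ n) (a n) x)‖ ^ 2 =
      (∫ x in Ω, ‖bpTail (R n) (ρ n) (a n) x‖ ^ 2) -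
        ∫ x in Ω, bpTail (R n) (ρ n) (a n) x 2 ^ 2 := by
    intro n
    have hi3 : Integrable (fun x => bpTail (R n) (ρ n) (a n) x 2 ^ 2) (volume.restrict Ω) := by
      refine ((hi1 n).sub (hi2 n)).congr (Eventually.of_forall fun x => ?_)
      simp only [Pi.sub_apply]
      rw [norm_sq_eq_inPlane_add (bpTail (R n) (ρ n) (a n) x)]
      ring
    rw [← integral_sub (hi1 n) hi3]
    congr 1
    ext1 x
    rw [norm_sq_eq_inPlane_add (bpTail (R n) (ρ n) (a n) x)]
    ring
  obtain ⟨D, hD, hΩD⟩ := exists_subset_ball_of_mem hb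
  have hsub : ∀ n, Ω ⊆ Metric.ball (a n) D := fun n => hΩD (a n) (haΩ n)
  have hvert : ∀ n, ∫ x in Ω, bpTail (R n) (ρ n) (a n) x 2 ^ 2 ≤
      2 * (|(R n).1 2 0| + |(R n).1 2 1|) ^ 2 * (∫ x in Ω, ‖bpTail (R n) (ρ n) (a n) x‖ ^ 2) +
        2 * (R n).1 2 2 ^ 2 * (4 * Real.pi * ρ n ^ 2) := by
    intro n
    have hc : Continuous fun x => (2 * ρ n ^ 2 / (ρ n ^ 2 + ‖x - a n‖ ^ 2)) ^ 2 :=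
      (continuous_const.div (by fun_prop) fun r => by have := hρ n; positivity).pow 2
    have hib : IntegrableOn (fun x => (2 * ρ n ^ 2 / (ρ n ^ 2 + ‖x - a n‖ ^ 2)) ^ 2)
        (Metric.ball (a n) D) :=
      (hc.continuousOn.integrableOn_compact (isCompact_closedBall _ _)).mono_set
        Metric.ball_subset_closedBall
    have hiΩ := hib.mono_set (hsub n)
    have hle : ∫ x in Ω, (2 * ρ n ^ 2 / (ρ n ^ 2 + ‖x - a n‖ ^ 2)) ^ 2 ≤
        4 * Real.pi * ρ n ^ 2 :=
      (setIntegral_mono_set hib (Eventually.of_forall fun x => sq_nonneg _)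
        (hsub n).eventuallyLE).trans (setIntegral_ball_sq_le (hρ n) (a n) hD.le)
    calc _ ≤ ∫ x in Ω, (2 * (|(R n).1 2 0| + |(R n).1 2 1|) ^ 2 * ‖bpTail (R n) (ρ n) (a n) x‖ ^ 2 +
          2 * (R n).1 2 2 ^ 2 * (2 * ρ n ^ 2 / (ρ n ^ 2 + ‖x - a n‖ ^ 2)) ^ 2) :=
        integral_mono_of_nonneg (Eventually.of_forall fun x => sq_nonneg _)
          (((hi1 n).const_mul _).add (hiΩ.const_mul _))
          (Eventually.of_forall fun x => sq_bpTail_two_le (R n) (hρ n) (a n) x)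
      _ = 2 * (|(R n).1 2 0| + |(R n).1 2 1|) ^ 2 * (∫ x in Ω, ‖bpTail (R n) (ρ n) (a n) x‖ ^ 2) +
          2 * (R n).1 2 2 ^ 2 * ∫ x in Ω, (2 * ρ n ^ 2 / (ρ n ^ 2 + ‖x - a n‖ ^ 2)) ^ 2 := by
        rw [integral_add ((hi1 n).const_mul _) (hiΩ.const_mul _), integral_const_mul,
          integral_const_mul]
      _ ≤ _ := by gcongr
  have hbottom := tendsto_bottom_row hR h₀.rotate_e3
  have hη := (((hbottom 0).abs.add (hbottom 1).abs).pow 2).const_mul 2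
  have hμ := ((hbottom 2).pow 2).const_mul 2
  have hρκ := ((hlim.pow 2).const_mul (4 * Real.pi)).mul (tendsto_inv_abs_log hκpos hκ)
  have hbd := (hη.mul hT).add (hμ.mul hρκ)
  have hv0 : Tendsto (fun n => (∫ x in Ω, bpTail (R n) (ρ n) (a n) x 2 ^ 2) / logScale (κ n))
      atTop (𝓝 0) := by
    refine tendsto_of_tendsto_of_tendsto_of_le_of_le tendsto_const_nhds
      (by simpa using hbd) (fun n => div_nonneg (integral_nonneg fun x => sq_nonneg _) (hL n))
      fun n => ?_
    refine (div_le_div_of_nonneg_right (hvert n) (hL n)).trans (le_of_eq ?_)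
    simp only [logScale]
    ring
  have := hT.sub hv0
  rw [sub_zero] at this
  refine this.congr fun n => ?_
  rw [hsplit n, sub_div]
  rfl

/-- The in-plane part of a BP-converging sequence is the one of the profile up to
an `L²` error of order `κ`, which is negligible against `κ |log κ|^{1/2}`. -/
theorem tendsto_integral_inPlaneSq {Ω : Set E2} (hΩ : IsOpen Ω) (hb : Bornology.IsBounded Ω)
    {κ : ℕ → ℝ} (hκpos : ∀ n, 0 < κ n) (hκ : Tendsto κ atTop (𝓝 0)) {R₀ : SO3} {r₀ : ℝ} {a₀ : E2}
    (h₀ : LimitAdmissible Ω R₀ r₀ a₀) {m : ℕ → E2 → E3} (hm : BPConverges Ω κ m R₀ r₀ a₀) :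
    Tendsto (fun n => (∫ x in Ω, inPlaneSq (m n) x) / logScale (κ n))
      atTop (𝓝 (8 * Real.pi * r₀ ^ 2)) := by
  have := isFiniteMeasure_restrict_of_isBounded hb
  obtain ⟨hadm, R, ρ, a, hρ, haΩ, hsup, hR, hlim, ha⟩ := hm
  obtain ⟨C, hC⟩ := exists_eLpNorm_sub_bpTail_le hΩ hb
  obtain ⟨M, hM1, hM2⟩ := exists_between hsup
  lift M to ℝ≥0 using hM2.ne
  have hψ : ∀ n, MemLp (bpTail (R n) (ρ n) (a n)) 2 (volume.restrict Ω) := fun n =>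
    memLp_bpTail (R n) (hρ n) (a n) _
  have hf : ∀ n, MemLp (fun x => m n x + e3) 2 (volume.restrict Ω) := fun n =>
    (hadm n).boundary.memH1.memLp
  let A : ℕ → ℝ := fun n => lpNorm (fun x => inPlane (m n x + e3)) 2 (volume.restrict Ω)
  let B : ℕ → ℝ := fun n => lpNorm (fun x => inPlane (bpTail (R n) (ρ n) (a n) x)) 2
    (volume.restrict Ω)
  let s : ℕ → ℝ := fun n => √(logScale (κ n))
  have hB := tendsto_integral_norm_sq_inPlane_bpTail hΩ hb hκpos hκ hρ h₀ haΩ hR hlim ha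
  have hL : ∀ n, 0 ≤ logScale (κ n) := fun n => by unfold logScale; positivity
  have hBs : Tendsto (fun n => B n / s n) atTop (𝓝 √(8 * Real.pi * r₀ ^ 2)) := by
    refine hB.sqrt.congr fun n => ?_
    rw [integral_norm_sq_eq_lpNorm_sq (memLp_inPlane (hψ n)).1, Real.sqrt_div (sq_nonneg _),
      Real.sqrt_sq lpNorm_nonneg]
  have hdiff : ∀ᶠ n in atTop, |A n - B n| ≤ C * (√M * κ n + ρ n) := by
    filter_upwards [eventually_lt_of_limsup_lt hM1] with n hn
    refine (abs_lpNorm_inPlane_sub_le (hf n) (hψ n)).trans ?_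
    have hk := hκpos n
    have hD : dirichletDistSq (m n) (bpMap (R n) (ρ n) (a n)) ^ (1 / 2 : ℝ) ≤
        ENNReal.ofReal (√M * κ n) := by
      have h1 : dirichletDistSq (m n) (bpMap (R n) (ρ n) (a n)) ≤ ENNReal.ofReal (M * κ n ^ 2) := by
        have h2 : ENNReal.ofReal (κ n ^ 2) * (ENNReal.ofReal ((κ n ^ 2)⁻¹) *
            dirichletDistSq (m n) (bpMap (R n) (ρ n) (a n))) ≤ ENNReal.ofReal (κ n ^ 2) * M := by
          gcongr
        rwa [← mul_assoc, ← ENNReal.ofReal_mul (by positivity), mul_inv_cancel₀ (by positivity),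
          ENNReal.ofReal_one, one_mul, mul_comm, ← ENNReal.ofReal_coe_nnreal,
          ← ENNReal.ofReal_mul M.coe_nonneg] at h2
      refine (ENNReal.rpow_le_rpow h1 (by norm_num)).trans (le_of_eq ?_)
      rw [ENNReal.ofReal_rpow_of_nonneg (by positivity) (by norm_num), ← Real.sqrt_eq_rpow,
        Real.sqrt_mul M.coe_nonneg, Real.sqrt_sq hk.le]
    have h3 := hC (m n) (hadm n) (R n) (ρ n) (a n) (hρ n) (haΩ n)
    have h4 : MemLp (fun x => m n x + e3 - bpTail (R n) (ρ n) (a n) x) 2 (volume.restrict Ω) :=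
      (hf n).sub (hψ n)
    rw [← toReal_eLpNorm h4.1]
    refine ENNReal.toReal_le_of_le_ofReal (by have := hρ n; positivity) (h3.trans ?_)
    rw [ENNReal.ofReal_mul C.coe_nonneg, ENNReal.ofReal_coe_nnreal,
      ENNReal.ofReal_add (by positivity) (hρ n).le]
    gcongr
  have hABs : Tendsto (fun n => A n / s n - B n / s n) atTop (𝓝 0) := by
    have hup : Tendsto (fun n => C * (√M + ρ n / κ n) * √(|Real.log (κ n)|⁻¹)) atTop (𝓝 0) := by
      have := ((hlim.const_add √M).const_mul (C : ℝ)).mul (tendsto_inv_abs_log hκpos hκ).sqrt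
      simpa using this
    refine squeeze_zero_norm' ?_ hup
    filter_upwards [hdiff] with n hn
    have hk := hκpos n
    rw [← sub_div, norm_div, Real.norm_eq_abs, Real.norm_eq_abs, abs_of_nonneg (Real.sqrt_nonneg _)]
    refine (div_le_div_of_nonneg_right hn (Real.sqrt_nonneg _)).trans (le_of_eq ?_)
    simp only [logScale]
    rw [Real.sqrt_mul (sq_nonneg _), Real.sqrt_sq hk.le, Real.sqrt_inv]
    field_simp
  have hAs : Tendsto (fun n => A n / s n) atTop (𝓝 √(8 * Real.pi * r₀ ^ 2)) := by
    have := hABs.add hBs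
    simpa using this
  have hfin := hAs.pow 2
  rw [Real.sq_sqrt (by positivity)] at hfin
  refine hfin.congr fun n => ?_
  rw [div_pow, Real.sq_sqrt (hL n),
    ← integral_norm_sq_eq_lpNorm_sq (memLp_inPlane (hf n)).1]
  congr 2
  ext1 x
  rw [inPlaneSq_eq]
  simp [inPlane_e3]

/-! ### Energies and Gamma-limits -/

theorem memLp_coord {μ : Measure E2} {f : E2 → E3} (hf : MemLp f 2 μ) (j : Fin 3) :
    MemLp (fun x => f x j) 2 μ :=
  (EuclideanSpace.proj (𝕜 := ℝ) j : E3 →L[ℝ] ℝ).comp_memLp' hf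

theorem anisotropicEnergy_sub_energy {Ω : Set E2} (hΩ : IsOpen Ω) (lam κ : ℝ) {m : E2 → E3}
    (hm : MemH1 Ω m) :
    anisotropicEnergy Ω lam κ m - energy Ω κ m =
      lam / |Real.log κ| * ∫ x in Ω, inPlaneSq m x := by
  have hg := hm.memLp_weakPartial hΩ
  have h1 : Integrable (gradSq Ω m) (volume.restrict Ω) :=
    integrable_finsetSum _ fun i _ => (hg i).integrable_norm_pow (by norm_num)
  have h2 : Integrable (dmiDensity Ω m) (volume.restrict Ω) :=
    ((memLp_coord hm.memLp 0).integrable_mul (memLp_coord (hg 0) 2)).add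
      ((memLp_coord hm.memLp 1).integrable_mul (memLp_coord (hg 1) 2))
  have h3 : Integrable (inPlaneSq m) (volume.restrict Ω) :=
    (memLp_coord hm.memLp 0).integrable_sq.add (memLp_coord hm.memLp 1).integrable_sq
  have h4 : Integrable (fun x => gradSq Ω m x - 2 * κ * dmiDensity Ω m x) (volume.restrict Ω) :=
    h1.sub (h2.const_mul _)
  rw [anisotropicEnergy, energy, integral_add h4 (h3.const_mul _),
    integral_const_mul]
  ring

theorem tendsto_energy_difference {Ω : Set E2} (hΩ : IsOpen Ω) (hb : Bornology.IsBounded Ω)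
    {κ : ℕ → ℝ} (hκpos : ∀ n, 0 < κ n) (hκ : Tendsto κ atTop (𝓝 0)) {R₀ : SO3} {r₀ : ℝ} {a₀ : E2}
    (h₀ : LimitAdmissible Ω R₀ r₀ a₀) (lam : ℝ) {m : ℕ → E2 → E3}
    (hm : BPConverges Ω κ m R₀ r₀ a₀) :
    Tendsto (fun n => (anisotropicEnergy Ω lam (κ n) (m n) - energy Ω (κ n) (m n)) / κ n ^ 2)
      atTop (𝓝 (8 * Real.pi * lam * r₀ ^ 2)) := by
  have h := (tendsto_integral_inPlaneSq hΩ hb hκpos hκ h₀ hm).const_mul lam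
  rw [show lam * (8 * Real.pi * r₀ ^ 2) = 8 * Real.pi * lam * r₀ ^ 2 by ring] at h
  refine h.congr fun n => ?_
  rw [anisotropicEnergy_sub_energy hΩ lam (κ n) (hm.1 n).memH1, logScale]
  ring

theorem liminf_coe_add_eq {u v : ℕ → ℝ} {c : ℝ} (hv : Tendsto v atTop (𝓝 c)) :
    liminf (fun n => ((u n + v n : ℝ) : EReal)) atTop =
      liminf (fun n => (u n : EReal)) atTop + (c : EReal) := by
  have hv' : Tendsto (fun n => (v n : EReal)) atTop (𝓝 (c : EReal)) :=
    (continuous_coe_real_ereal.tendsto c).comp hv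
  have h1 := EReal.le_liminf_add (u := fun n => (u n : EReal)) (v := fun n => (v n : EReal))
    (f := atTop)
  have h2 := EReal.liminf_add_le (u := fun n => (v n : EReal)) (v := fun n => (u n : EReal))
    (f := atTop) (Or.inl (by rw [hv'.limsup_eq]; exact EReal.coe_ne_bot c))
    (Or.inl (by rw [hv'.limsup_eq]; exact EReal.coe_ne_top c))
  rw [hv'.liminf_eq] at h1
  rw [hv'.limsup_eq, add_comm (c : EReal), add_comm (fun n => (v n : EReal))] at h2
  exact le_antisymm h2 h1

theorem limsup_coe_add_eq {u v : ℕ → ℝ} {c : ℝ} (hv : Tendsto v atTop (𝓝 c)) :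
    limsup (fun n => ((u n + v n : ℝ) : EReal)) atTop =
      limsup (fun n => (u n : EReal)) atTop + (c : EReal) := by
  have hv' : Tendsto (fun n => (v n : EReal)) atTop (𝓝 (c : EReal)) :=
    (continuous_coe_real_ereal.tendsto c).comp hv
  have h1 := EReal.le_limsup_add (u := fun n => (u n : EReal)) (v := fun n => (v n : EReal))
    (f := atTop)
  have h2 := EReal.limsup_add_le (u := fun n => (u n : EReal)) (v := fun n => (v n : EReal))
    (f := atTop) (Or.inr (by rw [hv'.limsup_eq]; exact EReal.coe_ne_top c))
    (Or.inr (by rw [hv'.limsup_eq]; exact EReal.coe_ne_bot c))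
  rw [hv'.liminf_eq] at h1
  rw [hv'.limsup_eq] at h2
  exact le_antisymm h2 h1

theorem iInf_add_real_eq {ι : Sort*} {p : ι → Prop} {L L' : ι → EReal} {c : ℝ}
    (h : ∀ i, p i → L' i = L i + (c : EReal)) :
    ⨅ (i) (_ : p i), L' i = (⨅ (i) (_ : p i), L i) + (c : EReal) := by
  refine le_antisymm ?_ (le_iInf₂ fun i hi => ?_)
  · refine (EReal.sub_le_iff_le_add (Or.inl (EReal.coe_ne_bot c))
      (Or.inl (EReal.coe_ne_top c))).1 (le_iInf₂ fun i hi => ?_)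
    refine (EReal.sub_le_iff_le_add (Or.inl (EReal.coe_ne_bot c))
      (Or.inl (EReal.coe_ne_top c))).2 ?_
    rw [← h i hi]
    exact iInf₂_le i hi
  · rw [h i hi]
    exact add_le_add_left (iInf₂_le i hi) _

end Skyrmion

theorem proposition2p9 (Ω : Set E2) (hΩ : IsBoundedLipschitzDomain Ω)
    (κ : ℕ → ℝ) (hκpos : ∀ n, 0 < κ n) (hκ : Tendsto κ atTop (𝓝 0))
    (R₀ : SO3) (r₀ : ℝ) (a₀ : E2) (hlim : LimitAdmissible Ω R₀ r₀ a₀) :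
    (∀ m : ℕ → E2 → E3, BPConverges Ω κ m R₀ r₀ a₀ →
      Tendsto (fun n => 1 / (κ n ^ 2 * |Real.log (κ n)|) * ∫ x in Ω, inPlaneSq (m n) x)
        atTop (𝓝 (8 * Real.pi * r₀ ^ 2))) ∧
    ∀ lam : ℝ,
      (∀ m : ℕ → E2 → E3, BPConverges Ω κ m R₀ r₀ a₀ →
        Tendsto (fun n => (anisotropicEnergy Ω lam (κ n) (m n) - energy Ω (κ n) (m n)) / κ n ^ 2)
          atTop (𝓝 (8 * Real.pi * lam * r₀ ^ 2))) ∧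
      gammaLiminf Ω (anisotropicEnergy Ω lam) κ R₀ r₀ a₀ =
        gammaLiminf Ω (energy Ω) κ R₀ r₀ a₀ + ((8 * Real.pi * lam * r₀ ^ 2 : ℝ) : EReal) ∧
      gammaLimsup Ω (anisotropicEnergy Ω lam) κ R₀ r₀ a₀ =
        gammaLimsup Ω (energy Ω) κ R₀ r₀ a₀ + ((8 * Real.pi * lam * r₀ ^ 2 : ℝ) : EReal) := by
  refine ⟨fun m hm => ?_, fun lam => ?_⟩
  · refine (tendsto_integral_inPlaneSq hΩ.isOpen hΩ.isBounded hκpos hκ hlim hm).congr fun n => ?_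
    rw [logScale, div_eq_inv_mul, one_div]
  have hdiff := fun m (hm : BPConverges Ω κ m R₀ r₀ a₀) =>
    tendsto_energy_difference hΩ.isOpen hΩ.isBounded hκpos hκ hlim lam hm
  have hsplit : ∀ (m : ℕ → E2 → E3) n, (anisotropicEnergy Ω lam (κ n) (m n) - 8 * Real.pi) /
      κ n ^ 2 = (energy Ω (κ n) (m n) - 8 * Real.pi) / κ n ^ 2 +
        (anisotropicEnergy Ω lam (κ n) (m n) - energy Ω (κ n) (m n)) / κ n ^ 2 := fun m n => by
    ring
  refine ⟨hdiff, iInf_add_real_eq fun m hm => ?_, iInf_add_real_eq fun m hm => ?_⟩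
  · simp only [hsplit]
    exact liminf_coe_add_eq (hdiff m hm)
  · simp only [hsplit]
    exact limsup_coe_add_eq (hdiff m hm)
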